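/- **Setting.** Let $\mathcal X,\mathcal Y$ be finite-dimensional Euclidean spaces, and give $\mathcal X\times\mathcal Y$ the inner product $\langle z,z'\rangle=\langle x,x'\rangle+\langle y,y'\rangle$. Let $X\subseteq\mathcal X$, $Y\subseteq\mathcal Y$ be compact convex sets with diameters at most $D_X$, $D_Y$, and $D=\sqrt{D_X^2+D_Y^2}$. In a game with utilities $u_1,u_2:X\times Y\to\mathbb R$, Player 1 maximizes $u_1(x,y)$ over $x\in X$ and Player 2 maximizes $u_2(x,y)$ over $y\in Y$. Put $g=-\tfrac12(u_1+u_2)$ and $h=\tfrac12(-u_1+u_2)$. A strongly monotone $\delta$-near-zero-sum game, with constants $\mu,\nu\in(0,L]$ and $\delta\in[0,L]$, is a game such that * $u_1,u_2$ are differentiable on $X\times Y$ with $L$-Lipschitz gradients; * $x\mapsto h(x,y)-\frac\mu2\|x\|^2$ is convex on $X$ for each $y\in Y$, and $y\mapsto h(x,y)+\frac\nu2\|y\|^2$ is concave on $Y$ for each $x\in X$; * $g$ is jointly convex on $X\times Y$ and $\nabla g$ is $\delta$-Lipschitz there. (If $X\times Y$ has empty interior, fix any gradient fields of $u_1,u_2$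 relative to $X\times Y$ with these Lipschitz properties.) A point $z^*=(x^*,y^*)\in X\times Y$ is a Nash equilibrium if $u_1(x^*,y^*)\ge u_1(x,y^*)$ for all $x\in X$ and $u_2(x^*,y^*)\ge u_2(x^*,y)$ for all $y\in Y$; a point $\bar z\in X\times Y$ is an $\epsilon$-accurate Nash equilibrium if $\|\bar z-z^*\|^2\le\epsilon$ for some Nash equilibrium $z^*$. **Algorithm (ICL, iterative coupling linearization).** Let $\epsilon>0$, $$\eta=\min\Big\{\frac1\delta,\frac1{\min\{\mu,\nu\}}\Big\}\ \Big(\tfrac10=\infty\Big),\qquad \theta=\frac{\min\{\mu,\nu\}}{\eta^{-1}+\min\{\mu,\nu\}},\qquad \epsilon_t=\frac{\theta\epsilon}{4\eta}.$$ From $z_0\in X\times Y$, for $t=0,1,\dots,T-1$, the algorithm finds $z_{t+1}=(x_{t+1},y_{t+1})\in X\times Y$ such that, for all $x\in X$, $y\in Y$, $$\langle\nabla_x\phi_t(z_{t+1}),x_{t+1}-x\rangle-\langle\nabla_y\phi_t(z_{t+1}),y_{t+1}-y\rangle\le\epsilon_t,$$ where $$\phi_t(x,y)=\langle\nabla_xg(z_t),x\rangle+\frac1{2\eta}\|x-x_t\|^2+h(x,y)-\langle\nabla_yg(z_t),y\rangle-\frac1{2\eta}\|y-y_t\|^2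 .$$ **Oracle model.** An inner-loop method is a deterministic adaptive procedure that, given $z_t$, computes $z_{t+1}$ and has access to the game only through gradient queries: one query at a point $z\in X\times Y$ returns $(\nabla u_1(z),\nabla u_2(z))$. It may use $X$, $Y$ and the numbers $D_X,D_Y,L,\mu,\nu,\delta,\epsilon$. Only queries are counted. **Theorem.** There is a universal constant $C>0$ such that for all $\mathcal X,\mathcal Y,X,Y,D_X,D_Y,L,\mu,\nu,\delta,\epsilon$ as above the following holds. 1. For every strongly monotone $\delta$-near-zero-sum game, every $T\ge\frac1\theta\log\frac{2D^2}{\epsilon}$ and every run $z_0,\dots,z_T$ of ICL (however the inexact solutions are found), $z_T$ is an $\epsilon$-accurate Nash equilibrium. 2. There is an inner-loop method (not depending on the game) such that, for every strongly monotone $\delta$-near-zero-sum game and every $z_0\in X\times Y$, the points $z_0,z_1,z_2,\dots$ that it produces form a run of ICL, $z_T$ is an $\epsilon$-accurate Nash equilibrium for every $T\ge\frac1\theta\log\frac{2D^2}\epsilon$, and the total number of gradient queries in the first $T_0=\max\{0,\lceil\frac1\theta\log\frac{2D^2}{\epsilon}\rceil\}$ outer iterations, after which this accuracy is reached, is at most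 $$C\left(\frac L{\sqrt{\mu\nu}}+\frac L{\min\{\mu,\nu\}}\min\Big\{1,\sqrt{\tfrac{\delta}{\mu+\nu}}\Big\}\right)\cdot\max\Big\{1,\log\frac{LD^2}{\min\{\mu,\nu\}\,\epsilon}\Big\}\cdot\max\Big\{1,\log\frac{D^2}\epsilon\Big\}.$$ (If $D=0$, the logarithms of $0$ are read as $0$.) -/

import Mathlib

namespace NearZeroSum

/-! ### Two-person games -/

section Games

variable {E F : Type*} [NormedAddCommGroup E] [InnerProductSpace ℝ E] [FiniteDimensional ℝ E]
  [NormedAddCommGroup F] [InnerProductSpace ℝ F] [FiniteDimensional ℝ F]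

/-- The Euclidean product of the two strategy spaces: its inner product is the sum of the inner
products of the components, so `‖(x, y)‖² = ‖x‖² + ‖y‖²`. -/
abbrev Pt (E F : Type*) := WithLp 2 (E × F)

/-- The point `(x, y)`. -/
abbrev pair (x : E) (y : F) : Pt E F := WithLp.toLp 2 (x, y)

/-- The set `X × Y` of feasible pairs of decisions. -/
def feasible (X : Set E) (Y : Set F) : Set (Pt E F) := {z | z.fst ∈ X ∧ z.snd ∈ Y}

/-- The utilities of the two players together with their gradient fields. Only the values on
`X × Y` matter; that `grad₁`, `grad₂` are gradients of `u₁`, `u₂` there is part of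
`IsNearZeroSum` below. (The fields are recorded as data because on a set `X × Y` with empty
interior the gradient relative to `X × Y` need not be unique.) -/
structure Game (E F : Type*) [NormedAddCommGroup E] [NormedAddCommGroup F] where
  u₁ : Pt E F → ℝ
  u₂ : Pt E F → ℝ
  grad₁ : Pt E F → Pt E F
  grad₂ : Pt E F → Pt E F

namespace Game

/-- The coupling part `g = -(u₁ + u₂) / 2`. -/
noncomputable def g (Γ : Game E F) (z : Pt E F) : ℝ := -(1 / 2) * (Γ.u₁ z + Γ.u₂ z)

/-- The zero-sum part `h = (-u₁ + u₂) / 2`. -/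
noncomputable def h (Γ : Game E F) (z : Pt E F) : ℝ := (1 / 2) * (-Γ.u₁ z + Γ.u₂ z)

/-- The gradient `∇g`. -/
noncomputable def gradG (Γ : Game E F) (z : Pt E F) : Pt E F :=
  (-(1 / 2) : ℝ) • (Γ.grad₁ z + Γ.grad₂ z)

/-- The gradient `∇h`. -/
noncomputable def gradH (Γ : Game E F) (z : Pt E F) : Pt E F :=
  (1 / 2 : ℝ) • (-Γ.grad₁ z + Γ.grad₂ z)

/-- `z = (x*, y*)` is a Nash equilibrium. -/
def IsNash (Γ : Game E F) (X : Set E) (Y : Set F) (z : Pt E F) : Prop :=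
  z ∈ feasible X Y ∧ (∀ x ∈ X, Γ.u₁ (pair x z.snd) ≤ Γ.u₁ z) ∧
    (∀ y ∈ Y, Γ.u₂ (pair z.fst y) ≤ Γ.u₂ z)

/-- `z` is an `ε`-accurate Nash equilibrium. -/
def IsAccurateNash (Γ : Game E F) (X : Set E) (Y : Set F) (ε : ℝ) (z : Pt E F) : Prop :=
  z ∈ feasible X Y ∧ ∃ zs : Pt E F, Γ.IsNash X Y zs ∧
    ‖z.fst - zs.fst‖ ^ 2 + ‖z.snd - zs.snd‖ ^ 2 ≤ ε

/-- Monotone `δ`-near-zero-sum games on `X × Y` with smoothness `L` and moduli `μ`, `ν`. The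
game is strongly monotone when moreover `0 < μ` and `0 < ν`. -/
structure IsNearZeroSum (Γ : Game E F) (X : Set E) (Y : Set F) (L μ ν δ : ℝ) : Prop where
  /-- the gradient fields are gradients of the utilities on `X × Y` -/
  hasGrad₁ : ∀ z ∈ feasible X Y, HasGradientWithinAt Γ.u₁ (Γ.grad₁ z) (feasible X Y) z
  hasGrad₂ : ∀ z ∈ feasible X Y, HasGradientWithinAt Γ.u₂ (Γ.grad₂ z) (feasible X Y) z
  /-- the utilities are `L`-smooth -/
  smooth₁ : ∀ z ∈ feasible X Y, ∀ z' ∈ feasible X Y, ‖Γ.grad₁ z' - Γ.grad₁ z‖ ≤ L * ‖z' - z‖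
  smooth₂ : ∀ z ∈ feasible X Y, ∀ z' ∈ feasible X Y, ‖Γ.grad₂ z' - Γ.grad₂ z‖ ≤ L * ‖z' - z‖
  /-- the zero-sum part is `μ`-strongly convex in `x` and `ν`-strongly concave in `y` -/
  mu_mem : μ ∈ Set.Icc 0 L
  nu_mem : ν ∈ Set.Icc 0 L
  convex_h : ∀ y ∈ Y, ConvexOn ℝ X (fun x => Γ.h (pair x y) - μ / 2 * ‖x‖ ^ 2)
  concave_h : ∀ x ∈ X, ConcaveOn ℝ Y (fun y => Γ.h (pair x y) + ν / 2 * ‖y‖ ^ 2)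
  /-- the coupling part is jointly convex and `δ`-smooth -/
  convex_g : ConvexOn ℝ (feasible X Y) Γ.g
  delta_mem : δ ∈ Set.Icc 0 L
  smooth_g : ∀ z ∈ feasible X Y, ∀ z' ∈ feasible X Y, ‖Γ.gradG z' - Γ.gradG z‖ ≤ δ * ‖z' - z‖

/-! ### The algorithm: iterative coupling linearization -/

/-- The objective `φ_t(x, y)` of the subproblem at the point `w = z_t` with step size `η`. -/
noncomputable def phi (Γ : Game E F) (η : ℝ) (w z : Pt E F) : ℝ :=
  inner ℝ (Γ.gradG w).fst z.fst + 1 / (2 * η) * ‖z.fst - w.fst‖ ^ 2 + Γ.h z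
    - inner ℝ (Γ.gradG w).snd z.snd - 1 / (2 * η) * ‖z.snd - w.snd‖ ^ 2

/-- The gradient `∇φ_t` at `z`; see `hasGradientWithinAt_phi`. -/
noncomputable def gradPhi (Γ : Game E F) (η : ℝ) (w z : Pt E F) : Pt E F :=
  pair ((Γ.gradG w).fst + (1 / η) • (z.fst - w.fst) + (Γ.gradH z).fst)
    ((Γ.gradH z).snd - (Γ.gradG w).snd - (1 / η) • (z.snd - w.snd))

/-- `gradPhi` is the gradient of `phi`. -/
theorem hasGradientWithinAt_phi (Γ : Game E F) {S : Set (Pt E F)} {η : ℝ} {w z : Pt E F}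
    (h₁ : HasGradientWithinAt Γ.u₁ (Γ.grad₁ z) S z)
    (h₂ : HasGradientWithinAt Γ.u₂ (Γ.grad₂ z) S z) :
    HasGradientWithinAt (Γ.phi η w) (Γ.gradPhi η w z) S z := by
  have hfst : HasFDerivWithinAt (fun z : Pt E F => z.fst) (WithLp.fstL 2 ℝ E F) S z :=
    (WithLp.fstL 2 ℝ E F).hasFDerivWithinAt
  have hsnd : HasFDerivWithinAt (fun z : Pt E F => z.snd) (WithLp.sndL 2 ℝ E F) S z :=
    (WithLp.sndL 2 ℝ E F).hasFDerivWithinAt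
  have hh := (h₁.hasFDerivWithinAt.neg.add h₂.hasFDerivWithinAt).const_mul (1 / 2 : ℝ)
  have key := (((((hasFDerivWithinAt_const (Γ.gradG w).fst z S).inner ℝ hfst).add
    ((hfst.sub_const w.fst).norm_sq.const_mul (1 / (2 * η)))).add hh).sub
    ((hasFDerivWithinAt_const (Γ.gradG w).snd z S).inner ℝ hsnd)).sub
    ((hsnd.sub_const w.snd).norm_sq.const_mul (1 / (2 * η)))
  rw [hasGradientWithinAt_iff_hasFDerivWithinAt]
  refine key.congr_fderiv ?_
  ext v
  simp [gradPhi, gradH, WithLp.prod_inner_apply, inner_add_left, inner_sub_left, inner_smul_left]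
  ring

/-- `z` is an admissible inexact solution, with accuracy `ε'`, of the saddle point problem
`min_{x ∈ X} max_{y ∈ Y} φ_t(x, y)` at the point `w = z_t`. -/
def IsInexactSolution (Γ : Game E F) (X : Set E) (Y : Set F) (η ε' : ℝ) (w z : Pt E F) : Prop :=
  ∀ x ∈ X, ∀ y ∈ Y, inner ℝ (Γ.gradPhi η w z).fst (z.fst - x)
    - inner ℝ (Γ.gradPhi η w z).snd (z.snd - y) ≤ ε'

/-- `z 0, …, z T` are outer iterates of the algorithm with `T` iterations, step size `η` and
inner accuracy `ε'`. -/
def IsICLRun (Γ : Game E F) (X : Set E) (Y : Set F) (η ε' : ℝ) (T : ℕ) (z : ℕ → Pt E F) : Prop :=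
  (∀ t ≤ T, z t ∈ feasible X Y) ∧
    ∀ t < T, Γ.IsInexactSolution X Y η ε' (z t) (z (t + 1))

/-- The first-order oracle of the game: one gradient query at a feasible point returns the
gradients of both utilities at this point. -/
def oracle (Γ : Game E F) (X : Set E) (Y : Set F) (z : feasible X Y) : Pt E F × Pt E F :=
  (Γ.grad₁ z, Γ.grad₂ z)

end Game

end Games

/-! ### Gradient methods in the black-box oracle model -/

/-- A deterministic adaptive procedure: it either stops with an output, or asks the oracle a
query and continues depending on the answer. -/
inductive OracleProc (Q A O : Type*) where
  | output (o : O) : OracleProc Q A O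
  | query (q : Q) (next : A → OracleProc Q A O) : OracleProc Q A O

namespace OracleProc

variable {Q A O : Type*}

/-- The output of the procedure when the oracle is `o`. -/
def run (o : Q → A) : OracleProc Q A O → O
  | output r => r
  | query q next => run o (next (o q))

/-- The number of queries made by the procedure when the oracle is `o`. -/
def cost (o : Q → A) : OracleProc Q A O → ℕ
  | output _ => 0
  | query q next => cost o (next (o q)) + 1

end OracleProc

section Method

variable {E F : Type*} [NormedAddCommGroup E] [InnerProductSpace ℝ E] [FiniteDimensional ℝ E]
  [NormedAddCommGroup F] [InnerProductSpace ℝ F] [FiniteDimensional ℝ F]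

/-- An inner-loop method: from the outer iterate `z_t` it computes, through gradient queries at
feasible points, the next outer iterate `z_{t+1}`. It sees the game only through the answers. -/
abbrev InnerMethod (X : Set E) (Y : Set F) :=
  feasible X Y → OracleProc (feasible X Y) (Pt E F × Pt E F) (feasible X Y)

namespace InnerMethod

/-- The outer iterates produced by the inner-loop method `S` on the game `Γ` from `z₀`. -/
def iterates {X : Set E} {Y : Set F} (S : InnerMethod X Y) (Γ : Game E F) (z₀ : feasible X Y) :
    ℕ → feasible X Y
  | 0 => z₀
  | t + 1 => (S (iterates S Γ z₀ t)).run (Γ.oracle X Y)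

/-- The total number of gradient queries made in the first `T` outer iterations. -/
def totalQueries {X : Set E} {Y : Set F} (S : InnerMethod X Y) (Γ : Game E F)
    (z₀ : feasible X Y) (T : ℕ) : ℕ :=
  ∑ t ∈ Finset.range T, (S (S.iterates Γ z₀ t)).cost (Γ.oracle X Y)

end InnerMethod

end Method

/-! ### Parameters -/

/-- `η = min {1/δ, 1/min {μ, ν}}`, where `1/0 = ∞`. -/
noncomputable def stepSize (μ ν δ : ℝ) : ℝ :=
  if δ = 0 then 1 / min μ ν else min (1 / δ) (1 / min μ ν)

/-- `θ = min {μ, ν} / (1/η + min {μ, ν})`. -/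
noncomputable def rate (μ ν δ : ℝ) : ℝ :=
  min μ ν / ((stepSize μ ν δ)⁻¹ + min μ ν)

/-- The inner accuracy `θ ε / (4 η)`. -/
noncomputable def innerAccuracy (μ ν δ ε : ℝ) : ℝ :=
  rate μ ν δ * ε / (4 * stepSize μ ν δ)

end NearZeroSum

open NearZeroSum

set_option linter.unusedSectionVars false

/-! Write `m = min μ ν` and `κ = 1/η = max δ m`. Since `g + h = -u₁` and `g - h = -u₂`, the
equilibrium solves the variational inequality of `∇g + (∇ₓh, -∇_y h)`, an `m`-strongly monotone
operator. An outer iteration is an inexact forward-backward step: explicit in `g`, implicit in `h`.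
As `g` is convex and `δ`-smooth with `δ ≤ κ`, the proximal term absorbs the linearization error, and
`‖z_t - z*‖² - ε/2` contracts by `1 - θ = κ/(κ + m)` however the subproblem was solved
(`outer_step`, `run_accurate`).

The subproblem `φ` is `a`-strongly convex and `b`-strongly concave with `a = μ + κ`, `b = ν + κ`,
and has an `l = L + κ` Lipschitz gradient. The goal is `O(l/√(ab))` queries up to one logarithm.
Exchanging the players, assume `a ≤ b`. The function `Ψ(x, s) = max_y φ(x, y) + (b/2)‖y - s‖²` is
`a`-strongly convex and is minimized at the saddle point `(x*, y*)`. An accelerated proximal point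
method on `Ψ` with parameter `b` needs about `√(b/a)` steps per constant factor
(`PotentialLE.step`). In a proximal step from `(c, d)` the minimization over `s` is explicit, `s =
(y + d)/2`, which leaves the saddle problem `φ + (b/2)‖x - c‖² + (b/4)‖y - d‖²` with condition
number `O(l/b)`. Hence `O(l/b)` averaged extragradient steps reach a fixed relative accuracy
(`proxProc_run`). That is enough without further logarithms: the inexactness only shifts `s`,
perturbs the subgradient, and adds an error paid for by the length of the step
(`ProxBound.subgradient`, `error_compensated`).

The number of outer iterations is `O(κ/m)` up to a logarithm, and `condition_number_le` bounds
`(κ/m) · L/√((μ + κ)(ν + κ))` by the claimed sum. -/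

namespace NearZeroSum

/-! ### Combinators for oracle procedures -/

namespace OracleProc

variable {Q A O O' Q' A' σ : Type*}

/-- Sequential composition of oracle procedures. -/
def bind : OracleProc Q A O → (O → OracleProc Q A O') → OracleProc Q A O'
  | output r, f => f r
  | query q next, f => query q (fun ans => bind (next ans) f)

theorem run_bind (o : Q → A) (p : OracleProc Q A O) (f : O → OracleProc Q A O') :
    (p.bind f).run o = (f (p.run o)).run o := by
  induction p with
  | output r => rfl
  | query q next ih => exact ih (o q)

theorem cost_bind (o : Q → A) (p : OracleProc Q A O) (f : O → OracleProc Q A O') :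
    (p.bind f).cost o = p.cost o + (f (p.run o)).cost o := by
  induction p with
  | output r => simp [bind, cost, run]
  | query q next ih => simp only [bind, cost, run, ih (o q)]; ring

/-- Simulate a procedure through another oracle, by translating queries and answers. -/
def mapOracle (f : Q → Q') (g : Q → A' → A) : OracleProc Q A O → OracleProc Q' A' O
  | output r => output r
  | query q next => query (f q) (fun ans => mapOracle f g (next (g q ans)))

theorem run_mapOracle (f : Q → Q') (g : Q → A' → A) (o : Q' → A') (p : OracleProc Q A O) :
    (p.mapOracle f g).run o = p.run (fun q => g q (o (f q))) := by
  induction p with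
  | output r => rfl
  | query q next ih => exact ih _

theorem cost_mapOracle (f : Q → Q') (g : Q → A' → A) (o : Q' → A') (p : OracleProc Q A O) :
    (p.mapOracle f g).cost o = p.cost (fun q => g q (o (f q))) := by
  induction p with
  | output r => rfl
  | query q next ih => simp only [mapOracle, cost, ih]

/-- Repeat a procedure that updates a state. -/
def loop (body : σ → OracleProc Q A σ) : ℕ → σ → OracleProc Q A σ
  | 0, s => output s
  | n + 1, s => (body s).bind (loop body n)

theorem run_loop (o : Q → A) (body : σ → OracleProc Q A σ) (n : ℕ) (s : σ) :
    (loop body n s).run o = (fun s => (body s).run o)^[n] s := by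
  induction n generalizing s with
  | zero => rfl
  | succ n ih => rw [loop, run_bind, ih, Function.iterate_succ_apply]

theorem cost_loop_le (o : Q → A) (body : σ → OracleProc Q A σ) {c : ℕ}
    (hc : ∀ s, (body s).cost o ≤ c) (n : ℕ) (s : σ) : (loop body n s).cost o ≤ n * c := by
  induction n generalizing s with
  | zero => simp [loop, cost]
  | succ n ih =>
    rw [loop, cost_bind, Nat.succ_mul, Nat.add_comm]
    exact Nat.add_le_add (ih _) (hc s)

end OracleProc

/-! ### Projections, variational inequalities and the extragradient method -/

section Hilbert

variable {H : Type*} [NormedAddCommGroup H] [InnerProductSpace ℝ H] {K : Set H}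

/-- `P` is the metric projection onto the convex set `K`. -/
def IsProj (P : H → K) : Prop := ∀ u, ∀ w : K, inner ℝ (u - P u) ((w : H) - P u) ≤ 0

theorem exists_isProj (hne : K.Nonempty) (hK : IsCompact K) (hconv : Convex ℝ K) :
    ∃ P : H → K, IsProj P := by
  have key : ∀ u : H, ∃ p : K, ∀ w : K, inner ℝ (u - p) ((w : H) - p) ≤ 0 := by
    intro u
    obtain ⟨p, hp, hmin⟩ := exists_norm_eq_iInf_of_complete_convex hne hK.isComplete hconv u
    exact ⟨⟨p, hp⟩, fun w => (norm_eq_iInf_iff_real_inner_le_zero hconv hp).1 hmin w w.2⟩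
  choose P hP using key
  exact ⟨P, hP⟩

namespace IsProj

variable {P : H → K} (hP : IsProj P)
include hP

theorem apply_coe (w : K) : P w = w := by
  have h := hP w w
  rw [real_inner_self_nonpos, sub_eq_zero] at h
  exact Subtype.ext h.symm

theorem norm_sub_le (u v : H) : ‖(P u : H) - P v‖ ≤ ‖u - v‖ := by
  have h1 := hP u (P v)
  have h2 := hP v (P u)
  have h3 : ‖(P u : H) - P v‖ ^ 2 ≤ inner ℝ (u - v) ((P u : H) - P v) := by
    rw [← real_inner_self_eq_norm_sq]
    simp only [inner_sub_left, inner_sub_right] at *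
    linarith
  have h4 := real_inner_le_norm (u - v) ((P u : H) - P v)
  by_contra! h
  nlinarith [norm_nonneg (u - v)]

theorem norm_sub_coe_le (u : H) (w : K) : ‖(P u : H) - w‖ ≤ ‖u - w‖ := by
  simpa [hP.apply_coe w] using hP.norm_sub_le u w

theorem norm_self_sub_le (u : H) (w : K) : ‖u - P u‖ ≤ ‖u - w‖ := by
  have h1 := hP u w
  have h2 : ‖u - P u‖ ^ 2 ≤ inner ℝ (u - P u) (u - w) := by
    have : u - (w : H) = (u - P u) - (w - P u) := by abel
    rw [this, inner_sub_right, real_inner_self_eq_norm_sq]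
    linarith
  have h4 := real_inner_le_norm (u - P u) (u - (w : H))
  by_contra! h
  nlinarith [norm_nonneg (u - (w : H))]

/-- A Lipschitz strongly monotone variational inequality on a compact convex set is solvable. -/
theorem exists_solution (hne : K.Nonempty) (hK : IsCompact K) {V : K → H} {m l : ℝ} (hm : 0 < m)
    (hlip : ∀ z w : K, ‖V z - V w‖ ≤ l * ‖(z : H) - w‖)
    (hmono : ∀ z w : K, m * ‖(z : H) - w‖ ^ 2 ≤ inner ℝ (V z - V w) ((z : H) - w)) :
    ∃ z : K, ∀ u : K, 0 ≤ inner ℝ (V z) ((u : H) - z) := by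
  -- Solutions are the fixed points of `z ↦ P (z - γ V z)`. Its squared Lipschitz constant is at
  -- most `1 - 2γm + γ²l'²`, which `γ = m / l'²` minimizes to `q`. Taking `l' ≥ m` ensures `0 ≤ q`.
  set l' := max l m with hl'
  have hl0 : 0 < l' := lt_of_lt_of_le hm (le_max_right _ _)
  have hlip' : ∀ z w : K, ‖V z - V w‖ ≤ l' * ‖(z : H) - w‖ := fun z w =>
    (hlip z w).trans (mul_le_mul_of_nonneg_right (le_max_left _ _) (norm_nonneg _))
  set γ := m / l' ^ 2 with hγ
  have hγ0 : 0 < γ := by positivity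
  set q := 1 - m ^ 2 / l' ^ 2 with hq
  have hq0 : 0 ≤ q := by
    rw [hq, sub_nonneg, div_le_one (by positivity)]
    exact pow_le_pow_left₀ hm.le (le_max_right _ _) 2
  have hq1 : q < 1 := by
    have : 0 < m ^ 2 / l' ^ 2 := by positivity
    linarith
  have hcontr : ∀ z w : K, ‖((z : H) - γ • V z) - (w - γ • V w)‖ ≤ √q * ‖(z : H) - w‖ := by
    intro z w
    have h1 := hmono z w
    have h2 := pow_le_pow_left₀ (norm_nonneg _) (hlip' z w) 2
    have h3 : ‖((z : H) - γ • V z) - (w - γ • V w)‖ ^ 2 ≤ q * ‖(z : H) - w‖ ^ 2 := by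
      have e : ((z : H) - γ • V z) - (w - γ • V w) = (z - w) - γ • (V z - V w) := by
        rw [smul_sub]; abel
      rw [e, norm_sub_sq_real, norm_smul, real_inner_smul_right, Real.norm_of_nonneg hγ0.le,
        real_inner_comm]
      have e2 : q = 1 - 2 * γ * m + γ ^ 2 * l' ^ 2 := by
        rw [hq, hγ]; field_simp; ring
      rw [e2]
      have h4 := mul_le_mul_of_nonneg_left h2 (sq_nonneg γ)
      have h5 := mul_le_mul_of_nonneg_left h1 hγ0.le
      nlinarith
    rw [← Real.sqrt_sq (norm_nonneg ((z : H) - w)), ← Real.sqrt_mul hq0]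
    exact Real.le_sqrt_of_sq_le h3
  have : CompleteSpace K := completeSpace_coe_iff_isComplete.2 hK.isComplete
  have : Nonempty K := hne.to_subtype
  have hc : ContractingWith (Real.toNNReal (√q)) (fun z : K => P ((z : H) - γ • V z)) := by
    refine ⟨?_, LipschitzWith.of_dist_le_mul fun z w => ?_⟩
    · rw [← Real.toNNReal_one, Real.toNNReal_lt_toNNReal_iff one_pos]
      rw [Real.sqrt_lt' one_pos]; simpa using hq1
    · rw [Real.coe_toNNReal _ (Real.sqrt_nonneg _), Subtype.dist_eq, Subtype.dist_eq,
        dist_eq_norm, dist_eq_norm]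
      exact (hP.norm_sub_le _ _).trans (hcontr z w)
  refine ⟨hc.fixedPoint _, fun u => ?_⟩
  have hfix : P (((hc.fixedPoint _ : K) : H) - γ • V (hc.fixedPoint _)) = hc.fixedPoint _ :=
    hc.fixedPoint_isFixedPt
  set z := hc.fixedPoint (fun z : K => P ((z : H) - γ • V z))
  have h := hP ((z : H) - γ • V z) u
  rw [hfix, sub_sub_cancel_left, inner_neg_left, real_inner_smul_left] at h
  nlinarith

/-- One step of the extragradient method. -/
theorem extragradient_step {V : K → H} {l γ : ℝ} (hγ : 0 ≤ γ) (hγl : γ * l ≤ 1)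
    (hlip : ∀ z w : K, ‖V z - V w‖ ≤ l * ‖(z : H) - w‖) (z u : K) :
    2 * γ * inner ℝ (V (P (z - γ • V z))) ((P (z - γ • V z) : H) - u) ≤
      ‖(z : H) - u‖ ^ 2 - ‖(P (z - γ • V (P (z - γ • V z))) : H) - u‖ ^ 2 := by
  set t := P (z - γ • V z)
  set n := P (z - γ • V t)
  have h1 := hP (z - γ • V t) u
  have h2 := hP (z - γ • V z) n
  change inner ℝ (z - γ • V t - (n : H)) ((u : H) - n) ≤ 0 at h1
  change inner ℝ (z - γ • V z - (t : H)) ((n : H) - t) ≤ 0 at h2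
  -- Using `V z` in place of `V t` for the midpoint costs this term. By `γ l ≤ 1` and Young's
  -- inequality it is covered by the squares left over from the two projection inequalities.
  have h3 : γ * inner ℝ (V t - V z) ((t : H) - n) ≤ ‖(t : H) - z‖ * ‖(t : H) - n‖ := by
    calc γ * inner ℝ (V t - V z) ((t : H) - n)
        ≤ γ * (l * ‖(t : H) - z‖ * ‖(t : H) - n‖) := by
          refine mul_le_mul_of_nonneg_left ((real_inner_le_norm _ _).trans ?_) hγ
          exact mul_le_mul_of_nonneg_right (hlip t z) (norm_nonneg _)
      _ = γ * l * (‖(t : H) - z‖ * ‖(t : H) - n‖) := by ring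
      _ ≤ 1 * (‖(t : H) - z‖ * ‖(t : H) - n‖) :=
          mul_le_mul_of_nonneg_right hγl (by positivity)
      _ = _ := one_mul _
  have h4 : 2 * (‖(t : H) - z‖ * ‖(t : H) - n‖) ≤ ‖(t : H) - z‖ ^ 2 + ‖(t : H) - n‖ ^ 2 := by
    nlinarith [sq_nonneg (‖(t : H) - z‖ - ‖(t : H) - n‖)]
  simp only [← real_inner_self_eq_norm_sq, inner_sub_left, inner_sub_right,
    real_inner_smul_left] at h1 h2 h3 h4 ⊢
  have c := fun x y : H => real_inner_comm x y
  linarith [c z u, c z t, c z n, c u t, c u n, c t n]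

/-- A projected step from a point near the solution `zs` nearly solves the inequality. -/
theorem projected_step {V : K → H} {l r d : ℝ} (hl : 0 < l)
    (hlip : ∀ z w : K, ‖V z - V w‖ ≤ l * ‖(z : H) - w‖) {zs : K}
    (hzs : ∀ u : K, 0 ≤ inner ℝ (V zs) ((u : H) - zs)) {z : K} (hz : ‖(z : H) - zs‖ ≤ r)
    (hd : ∀ u w : K, ‖(u : H) - w‖ ≤ d) (u : K) :
    inner ℝ (V (P (z - l⁻¹ • V z))) ((P (z - l⁻¹ • V z) : H) - u) ≤ 6 * l * r * d := by
  have hl' : 0 < l⁻¹ := inv_pos.2 hl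
  have hfix : P ((zs : H) - l⁻¹ • V zs) = zs := by
    have h := hP ((zs : H) - l⁻¹ • V zs) zs
    set p := P ((zs : H) - l⁻¹ • V zs)
    have h' := hzs p
    have e : (zs : H) - l⁻¹ • V zs - p = (zs - p) - l⁻¹ • V zs := by abel
    have e2 : (p : H) - zs = -(zs - p) := by abel
    rw [e, inner_sub_left, real_inner_smul_left] at h
    rw [e2, inner_neg_right] at h'
    have : inner ℝ ((zs : H) - p) ((zs : H) - p) ≤ 0 := by nlinarith
    rw [real_inner_self_nonpos, sub_eq_zero] at this
    exact Subtype.ext this.symm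
  set p := P (z - l⁻¹ • V z) with hp
  have h1 : ‖(p : H) - zs‖ ≤ 2 * r := by
    have := hP.norm_sub_le (z - l⁻¹ • V z) ((zs : H) - l⁻¹ • V zs)
    rw [hfix, ← hp] at this
    refine this.trans ?_
    have e : (z : H) - l⁻¹ • V z - (zs - l⁻¹ • V zs) = (z - zs) - l⁻¹ • (V z - V zs) := by
      rw [smul_sub]; abel
    have h2 : ‖l⁻¹ • (V z - V zs)‖ ≤ ‖(z : H) - zs‖ := by
      rw [norm_smul, Real.norm_of_nonneg hl'.le, inv_mul_le_iff₀ hl]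
      exact hlip z zs
    rw [e]
    linarith [_root_.norm_sub_le ((z : H) - zs) (l⁻¹ • (V z - V zs))]
  have h3 : ‖(p : H) - z‖ ≤ 3 * r := by
    have e : (p : H) - z = (p - zs) - (z - zs) := by abel
    rw [e]
    linarith [_root_.norm_sub_le ((p : H) - zs) ((z : H) - zs)]
  have h4 := hP (z - l⁻¹ • V z) u
  rw [← hp] at h4
  -- The projection inequality controls `V z`, not `V p`. Both resulting terms are at most `l * ‖p -
  -- z‖ * d ≤ 3 l r d`, hence the factor 6.
  have h5 : inner ℝ (V p) ((p : H) - u) ≤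
      inner ℝ (V p - V z) ((p : H) - u) + l * inner ℝ ((z : H) - p) ((p : H) - u) := by
    have e : (u : H) - p = -(p - u) := by abel
    have e2 : (z : H) - l⁻¹ • V z - p = (z - p) - l⁻¹ • V z := by abel
    rw [e, e2, inner_neg_right, inner_sub_left, real_inner_smul_left] at h4
    rw [inner_sub_left]
    have := mul_le_mul_of_nonneg_left h4 hl.le
    have e3 : l * (l⁻¹ * inner ℝ (V z) ((p : H) - u)) = inner ℝ (V z) ((p : H) - u) := by
      rw [← mul_assoc, mul_inv_cancel₀ hl.ne', one_mul]
    nlinarith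
  have hr : 0 ≤ r := (norm_nonneg _).trans hz
  have h6 : inner ℝ (V p - V z) ((p : H) - u) ≤ l * (3 * r) * d :=
    (real_inner_le_norm _ _).trans (mul_le_mul ((hlip p z).trans
      (mul_le_mul_of_nonneg_left h3 hl.le)) (hd p u) (norm_nonneg _) (by positivity))
  have h7 : inner ℝ ((z : H) - p) ((p : H) - u) ≤ 3 * r * d := by
    refine (real_inner_le_norm _ _).trans (mul_le_mul ?_ (hd p u) (norm_nonneg _) (by positivity))
    rwa [norm_sub_rev]
  nlinarith [mul_le_mul_of_nonneg_left h7 hl.le]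

end IsProj

/-- One extragradient step as an oracle procedure. The oracle answers with an operator, to which
the known map `reg` is added; the state is the current point and the sum of the midpoints. -/
def extragradientStep (P : H → K) (γ : ℝ) (reg : H → H) (s : K × H) : OracleProc K H (K × H) :=
  .query s.1 fun v =>
    .query (P (s.1 - γ • (v + reg s.1))) fun v' =>
      .output (P (s.1 - γ • (v' + reg (P (s.1 - γ • (v + reg s.1))))),
        s.2 + P (s.1 - γ • (v + reg s.1)))

/-- The extragradient method with `T` steps from `P c`; the output is the last point and the
average of the midpoints. -/
noncomputable def extragradient (P : H → K) (γ : ℝ) (reg : H → H) (T : ℕ) (c : H) :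
    OracleProc K H (K × H) :=
  (OracleProc.loop (extragradientStep P γ reg) T (P c, 0)).bind
    fun s => .output (s.1, (T : ℝ)⁻¹ • s.2)

theorem cost_extragradient_le (P : H → K) (γ : ℝ) (reg : H → H) (T : ℕ) (c : H) (o : K → H) :
    (extragradient P γ reg T c).cost o ≤ T * 2 := by
  rw [extragradient, OracleProc.cost_bind]
  exact OracleProc.cost_loop_le o (extragradientStep P γ reg) (c := 2) (fun s => le_rfl) T _

/-- The one-step inequalities telescope. The final distance is kept on the right because the later
analysis uses the last point as well as the average. -/
theorem extragradient_run {P : H → K} (hP : IsProj P) {reg : H → H} {o : K → H} {l γ : ℝ}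
    (hγ : 0 ≤ γ) (hγl : γ * l ≤ 1)
    (hlip : ∀ z w : K, ‖(o z + reg z) - (o w + reg w)‖ ≤ l * ‖(z : H) - w‖) (T : ℕ) (c : H) :
    ∃ t : ℕ → K,
      ((extragradient P γ reg T c).run o).2 = (T : ℝ)⁻¹ • ∑ i ∈ Finset.range T, (t i : H) ∧
      ∀ u : K, 2 * γ * ∑ i ∈ Finset.range T, inner ℝ (o (t i) + reg (t i)) ((t i : H) - u) ≤
        ‖(P c : H) - u‖ ^ 2 - ‖(((extragradient P γ reg T c).run o).1 : H) - u‖ ^ 2 := by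
  set step := fun s => (extragradientStep P γ reg s).run o with hstep
  let s : ℕ → K × H := fun n => step^[n] (P c, 0)
  have hs : ∀ n, s (n + 1) = step (s n) := fun n => Function.iterate_succ_apply' _ _ _
  let t : ℕ → K := fun i => P ((s i).1 - γ • (o (s i).1 + reg (s i).1))
  have hrun : (extragradient P γ reg T c).run o = ((s T).1, (T : ℝ)⁻¹ • (s T).2) := by
    rw [extragradient, OracleProc.run_bind, OracleProc.run_loop]; rfl
  have key : ∀ n, (s n).2 = ∑ i ∈ Finset.range n, (t i : H) ∧
      ∀ u : K, 2 * γ * ∑ i ∈ Finset.range n, inner ℝ (o (t i) + reg (t i)) ((t i : H) - u) ≤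
        ‖(P c : H) - u‖ ^ 2 - ‖((s n).1 : H) - u‖ ^ 2 := by
    intro n
    induction n with
    | zero => simp [s]
    | succ n ih =>
      refine ⟨?_, fun u => ?_⟩
      · rw [Finset.sum_range_succ, ← ih.1, hs]; rfl
      · have h := hP.extragradient_step (V := fun z => o z + reg z) hγ hγl hlip (s n).1 u
        have h' := ih.2 u
        rw [Finset.sum_range_succ, mul_add, hs]
        have e : (step (s n)).1 = P ((s n).1 - γ • (o (t n) + reg (t n))) := rfl
        rw [e]
        linarith
  rw [hrun]
  exact ⟨t, by rw [(key T).1], (key T).2⟩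

end Hilbert

/-! ### Euclidean norm of a pair -/

theorem pair_fst {E F : Type*} (x : E) (y : F) : (pair x y).fst = x := rfl

theorem pair_snd {E F : Type*} (x : E) (y : F) : (pair x y).snd = y := rfl

section Norm

variable {E F : Type*} [NormedAddCommGroup E] [NormedAddCommGroup F]

theorem norm_sq_pt (z : Pt E F) : ‖z‖ ^ 2 = ‖z.fst‖ ^ 2 + ‖z.snd‖ ^ 2 :=
  WithLp.prod_norm_sq_eq_of_L2 z

theorem norm_fst_le (z : Pt E F) : ‖z.fst‖ ≤ ‖z‖ := by
  refine le_of_sq_le_sq ?_ (norm_nonneg _)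
  nlinarith [norm_sq_pt z, sq_nonneg ‖z.snd‖]

theorem norm_snd_le (z : Pt E F) : ‖z.snd‖ ≤ ‖z‖ := by
  refine le_of_sq_le_sq ?_ (norm_nonneg _)
  nlinarith [norm_sq_pt z, sq_nonneg ‖z.fst‖]

end Norm

/-! ### Saddle functions and the proximal subproblem -/

section Saddle

variable {E F : Type*} [NormedAddCommGroup E] [InnerProductSpace ℝ E]
  [NormedAddCommGroup F] [InnerProductSpace ℝ F]

theorem inner_pt (z w : Pt E F) :
    inner ℝ z w = inner ℝ z.fst w.fst + inner ℝ z.snd w.snd :=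
  WithLp.prod_inner_apply z w

/-- The monotone operator `(∂ₓφ, -∂_yφ)`. -/
def saddleOp (gx : E → F → E) (gy : E → F → F) (z : Pt E F) : Pt E F :=
  pair (gx z.fst z.snd) (-gy z.fst z.snd)

/-- `φ` is `a`-strongly convex in `x ∈ X`, `b`-strongly concave in `y ∈ Y`, with partial gradients
`gx`, `gy` that are jointly `l`-Lipschitz. -/
structure IsSaddle (X : Set E) (Y : Set F) (a b l : ℝ) (φ : E → F → ℝ) (gx : E → F → E)
    (gy : E → F → F) : Prop where
  convex : ∀ x ∈ X, ∀ x' ∈ X, ∀ y ∈ Y,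
    φ x y + inner ℝ (gx x y) (x' - x) + a / 2 * ‖x' - x‖ ^ 2 ≤ φ x' y
  concave : ∀ x ∈ X, ∀ y ∈ Y, ∀ y' ∈ Y,
    φ x y' ≤ φ x y + inner ℝ (gy x y) (y' - y) - b / 2 * ‖y' - y‖ ^ 2
  lip : ∀ z w : feasible X Y, ‖saddleOp gx gy z - saddleOp gx gy w‖ ≤ l * ‖(z : Pt E F) - w‖

/-- The gradient of the regularization used in the proximal subproblem with center `C`. -/
noncomputable def proxReg (b : ℝ) (C z : Pt E F) : Pt E F :=
  pair (b • (z.fst - C.fst)) (-((b / 2) • (z.snd - C.snd)))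

variable {X : Set E} {Y : Set F} {a b l : ℝ} {φ : E → F → ℝ} {gx : E → F → E} {gy : E → F → F}

namespace IsSaddle

theorem strongly_monotone (h : IsSaddle X Y a b l φ gx gy) (z w : feasible X Y) :
    a * ‖(z : Pt E F).fst - (w : Pt E F).fst‖ ^ 2 + b * ‖(z : Pt E F).snd - (w : Pt E F).snd‖ ^ 2 ≤
      inner ℝ (saddleOp gx gy z - saddleOp gx gy w) ((z : Pt E F) - w) := by
  obtain ⟨z, hz⟩ := z
  obtain ⟨w, hw⟩ := w
  have h1 := h.convex _ hz.1 _ hw.1 _ hz.2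
  have h2 := h.convex _ hw.1 _ hz.1 _ hw.2
  have h3 := h.concave _ hz.1 _ hz.2 _ hw.2
  have h4 := h.concave _ hw.1 _ hw.2 _ hz.2
  simp only [inner_pt, saddleOp, pair_fst, pair_snd, WithLp.sub_fst, WithLp.sub_snd, inner_sub_left, inner_neg_left]
  rw [norm_sub_rev w.fst] at h1
  rw [norm_sub_rev w.snd] at h3
  simp only [inner_sub_right] at *
  linarith

/-- `proxReg` comes from adding `(b/2)‖x - C.fst‖² + (b/4)‖y - C.snd‖²` to `φ`. The second term is
convex in the maximizing variable, so it uses up half of the concavity `b`. -/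
theorem prox_strongly_monotone (h : IsSaddle X Y a b l φ gx gy) (C : Pt E F)
    (z w : feasible X Y) :
    (a + b) * ‖(z : Pt E F).fst - (w : Pt E F).fst‖ ^ 2
      + b / 2 * ‖(z : Pt E F).snd - (w : Pt E F).snd‖ ^ 2 ≤
      inner ℝ ((saddleOp gx gy z + proxReg b C z) - (saddleOp gx gy w + proxReg b C w))
        ((z : Pt E F) - w) := by
  have h1 := h.strongly_monotone z w
  have e : (saddleOp gx gy z + proxReg b C z) - (saddleOp gx gy w + proxReg b C w) =
      (saddleOp gx gy z - saddleOp gx gy w) + (proxReg b C z - proxReg b C w) := by abel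
  have e2 : inner ℝ (proxReg b C z - proxReg b C w) ((z : Pt E F) - w) =
      b * ‖(z : Pt E F).fst - (w : Pt E F).fst‖ ^ 2
        - b / 2 * ‖(z : Pt E F).snd - (w : Pt E F).snd‖ ^ 2 := by
    simp only [inner_pt, proxReg, pair_fst, pair_snd, ← real_inner_self_eq_norm_sq,
      inner_sub_left, inner_sub_right, inner_neg_left, real_inner_smul_left]
    ring
  rw [e, inner_add_left, e2]
  linarith

theorem prox_lip (h : IsSaddle X Y a b l φ gx gy) (hb : 0 < b) (C : Pt E F)
    (z w : feasible X Y) :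
    ‖(saddleOp gx gy z + proxReg b C z) - (saddleOp gx gy w + proxReg b C w)‖ ≤
      (l + b) * ‖(z : Pt E F) - w‖ := by
  have e : (saddleOp gx gy z + proxReg b C z) - (saddleOp gx gy w + proxReg b C w) =
      (saddleOp gx gy z - saddleOp gx gy w) + (proxReg b C z - proxReg b C w) := by abel
  have e2 : ‖proxReg b C z - proxReg b C w‖ ≤ b * ‖(z : Pt E F) - w‖ := by
    refine le_of_sq_le_sq ?_ (by positivity)
    rw [mul_pow, norm_sq_pt, norm_sq_pt ((z : Pt E F) - (w : Pt E F))]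
    have e3 : (proxReg b C z - proxReg b C w).fst = b • ((z : Pt E F) - (w : Pt E F)).fst := by
      simp only [proxReg, pair_fst, WithLp.sub_fst, ← smul_sub]; congr 1; abel
    have e4 : (proxReg b C z - proxReg b C w).snd =
        -((b / 2) • ((z : Pt E F) - (w : Pt E F)).snd) := by
      simp only [proxReg, pair_snd, WithLp.sub_snd, ← neg_sub', ← smul_sub]; congr 2; abel
    rw [e3, e4, norm_neg, norm_smul, norm_smul, Real.norm_of_nonneg hb.le,
      Real.norm_of_nonneg (by positivity : 0 ≤ b / 2)]
    nlinarith [sq_nonneg (b * ‖((z : Pt E F) - (w : Pt E F)).snd‖)]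
  rw [e, add_mul]
  exact (norm_add_le _ _).trans (add_le_add (h.lip z w) e2)

end IsSaddle

/-- The inequality delivered by averaged extragradient steps on the proximal subproblem with
center `C`, started at `z₀`, ended at `zT`, with average `zb`. -/
def ProxBound (X : Set E) (Y : Set F) (a b τ : ℝ) (φ : E → F → ℝ) (C z₀ zT zb : Pt E F) : Prop :=
  ∀ x ∈ X, ∀ y ∈ Y,
    φ zb.fst y - φ x zb.snd + a / 2 * ‖zb.fst - x‖ ^ 2 + b / 2 * ‖y - zb.snd‖ ^ 2
      + b * inner ℝ (zb.fst - C.fst) (zb.fst - x)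
      - b / 2 * inner ℝ (zb.snd - C.snd) (zb.snd - y) ≤
    τ * b * (‖z₀ - pair x y‖ ^ 2 - ‖zT - pair x y‖ ^ 2)

theorem convex_feasible (hX : Convex ℝ X) (hY : Convex ℝ Y) : Convex ℝ (feasible X Y) := by
  intro z hz w hw s t hs ht hst
  exact ⟨hX hz.1 hw.1 hs ht hst, hY hz.2 hw.2 hs ht hst⟩

/-- The gap at a midpoint `t` is bounded below by its tangent at `zb`. The part quadratic in `t.snd`
cancels exactly between the strong concavity and the regularization, so nothing is lost there. The
last inner product on the left is linear in `t - zb` and vanishes when `zb` is the average of the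
midpoints. -/
theorem IsSaddle.linearized (h : IsSaddle X Y a b l φ gx gy) (ha : 0 ≤ a) (hb : 0 ≤ b)
    {C zb t : Pt E F} (hzb : zb ∈ feasible X Y) (ht : t ∈ feasible X Y) {x : E} (hx : x ∈ X)
    {y : F} (hy : y ∈ Y) :
    φ zb.fst y - φ x zb.snd + a / 2 * ‖zb.fst - x‖ ^ 2 + b / 2 * ‖y - zb.snd‖ ^ 2
      + b * inner ℝ (zb.fst - C.fst) (zb.fst - x)
      - b / 2 * inner ℝ (zb.snd - C.snd) (zb.snd - y)
      + inner ℝ (pair (gx zb.fst y + a • (zb.fst - x) + b • (zb.fst - C.fst + (zb.fst - x)))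
          (-gy x zb.snd + (b / 2) • (C.snd - y))) (t - zb) ≤
    inner ℝ (saddleOp gx gy t + proxReg b C t) (t - pair x y) := by
  have h1 := h.convex _ ht.1 _ hx _ ht.2
  have h2 := h.concave _ ht.1 _ ht.2 _ hy
  have h3 := h.convex _ hzb.1 _ ht.1 _ hy
  have h4 := h.concave _ hx _ hzb.2 _ ht.2
  have h5 : 0 ≤ (a / 2 + b) * ‖t.fst - zb.fst‖ ^ 2 := by positivity
  have h6 : 0 ≤ a / 2 * ‖t.fst - zb.fst‖ ^ 2 := by positivity
  have h7 : 0 ≤ b / 2 * ‖t.snd - zb.snd‖ ^ 2 := by positivity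
  simp only [inner_pt, saddleOp, proxReg, pair_fst, pair_snd,
    ← real_inner_self_eq_norm_sq, inner_add_left,
    inner_sub_left, inner_sub_right, inner_neg_left, real_inner_smul_left] at *
  have c := fun x y : E => real_inner_comm x y
  have c' := fun x y : F => real_inner_comm x y
  rw [c zb.fst t.fst, c x t.fst] at *
  rw [c x zb.fst] at *
  rw [c' zb.snd t.snd, c' y t.snd] at *
  rw [c' y zb.snd] at *
  nlinarith

/-- Averaging extragradient steps. -/
theorem IsSaddle.proxBound_average (h : IsSaddle X Y a b l φ gx gy) (ha : 0 ≤ a) (hb : 0 < b)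
    (hX : Convex ℝ X) (hY : Convex ℝ Y) {γ : ℝ} (hγ : 0 < γ) {T : ℕ} (hT : 0 < T)
    {C z₀ zT zb : Pt E F} {t : ℕ → feasible X Y}
    (hzb : zb = (T : ℝ)⁻¹ • ∑ i ∈ Finset.range T, (t i : Pt E F))
    (hsum : ∀ u : feasible X Y, 2 * γ * ∑ i ∈ Finset.range T,
      inner ℝ (saddleOp gx gy (t i) + proxReg b C (t i)) ((t i : Pt E F) - u) ≤
        ‖z₀ - u‖ ^ 2 - ‖zT - u‖ ^ 2) :
    zb ∈ feasible X Y ∧ ProxBound X Y a b (1 / (2 * γ * T * b)) φ C z₀ zT zb := by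
  have hT' : (0 : ℝ) < T := by exact_mod_cast hT
  have hmem : zb ∈ feasible X Y := by
    rw [hzb, Finset.smul_sum]
    refine (convex_feasible hX hY).sum_mem (fun _ _ => by positivity) ?_ fun i _ => (t i).2
    simp [hT'.ne']
  refine ⟨hmem, fun x hx y hy => ?_⟩
  have h1 := Finset.sum_le_sum fun i (_ : i ∈ Finset.range T) =>
    h.linearized ha hb.le (C := C) hmem (t i).2 hx hy
  rw [Finset.sum_add_distrib, ← inner_sum, Finset.sum_const, Finset.card_range] at h1
  have e : ∑ i ∈ Finset.range T, ((t i : Pt E F) - zb) = 0 := by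
    rw [Finset.sum_sub_distrib, Finset.sum_const, Finset.card_range, hzb, ← Nat.cast_smul_eq_nsmul ℝ, smul_smul, mul_inv_cancel₀ hT'.ne', one_smul, sub_self]
  rw [e, inner_zero_right, add_zero, nsmul_eq_mul] at h1
  have h2 := hsum ⟨pair x y, hx, hy⟩
  have e2 : 1 / (2 * γ * T * b) * b * (‖z₀ - pair x y‖ ^ 2 - ‖zT - pair x y‖ ^ 2) =
      (‖z₀ - pair x y‖ ^ 2 - ‖zT - pair x y‖ ^ 2) / (2 * γ * T) := by
    field_simp
  rw [e2, le_div_iff₀ (by positivity)]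
  have h3 := mul_le_mul_of_nonneg_left h1 (by positivity : 0 ≤ 2 * γ)
  change 2 * γ * ∑ i ∈ Finset.range T,
      inner ℝ (saddleOp gx gy (t i) + proxReg b C (t i)) ((t i : Pt E F) - pair x y) ≤
        ‖z₀ - pair x y‖ ^ 2 - ‖zT - pair x y‖ ^ 2 at h2
  linarith

/-- Distance of the average to the exact solution `zp` of the proximal subproblem. -/
theorem ProxBound.norm_sub_sq_le (h : IsSaddle X Y a b l φ gx gy) (ha : 0 ≤ a) (hb : 0 < b)
    {τ : ℝ} {C z₀ zT zb : Pt E F} (hzb : zb ∈ feasible X Y)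
    (hA : ProxBound X Y a b τ φ C z₀ zT zb) {zp : feasible X Y}
    (hzp : ∀ u : feasible X Y, 0 ≤ inner ℝ (saddleOp gx gy zp + proxReg b C zp)
      ((u : Pt E F) - zp)) :
    ‖zb - zp‖ ^ 2 ≤ 2 * τ * (‖z₀ - zp‖ ^ 2 - ‖zT - zp‖ ^ 2) := by
  obtain ⟨zp, hp⟩ := zp
  have h0 := hzp ⟨zb, hzb⟩
  have h1 := h.convex _ hp.1 _ hzb.1 _ hp.2
  have h2 := h.concave _ hp.1 _ hp.2 _ hzb.2
  have h3 := hA _ hp.1 _ hp.2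
  change _ ≤ τ * b * (‖z₀ - zp‖ ^ 2 - ‖zT - zp‖ ^ 2) at h3
  change _ ≤ 2 * τ * (‖z₀ - zp‖ ^ 2 - ‖zT - zp‖ ^ 2)
  have h4 : 0 ≤ (a + b / 2) * ‖zb.fst - zp.fst‖ ^ 2 := by positivity
  have key : b / 2 * ‖zb - zp‖ ^ 2 ≤ τ * b * (‖z₀ - zp‖ ^ 2 - ‖zT - zp‖ ^ 2) := by
    refine le_trans ?_ h3
    clear h3
    rw [norm_sq_pt (zb - zp)]
    simp only [inner_pt, saddleOp, proxReg, pair_fst, pair_snd, WithLp.sub_fst, WithLp.sub_snd,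
      ← real_inner_self_eq_norm_sq, inner_add_left,
      inner_sub_left, inner_sub_right, inner_neg_left, real_inner_smul_left] at *
    have c := fun x y : E => real_inner_comm x y
    have c' := fun x y : F => real_inner_comm x y
    rw [c zp.fst zb.fst] at *
    rw [c' zp.snd zb.snd] at *
    nlinarith
  have : b / 2 * ‖zb - zp‖ ^ 2 ≤ b / 2 * (2 * τ * (‖z₀ - zp‖ ^ 2 - ‖zT - zp‖ ^ 2)) := by linarith
  exact le_of_mul_le_mul_left this (by positivity)

end Saddle

/-! ### Accelerated inexact proximal point method -/

section Accelerated

variable {E F : Type*} [NormedAddCommGroup E] [InnerProductSpace ℝ E]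
  [NormedAddCommGroup F] [InnerProductSpace ℝ F]
  {X : Set E} {Y : Set F} {a b l : ℝ} {φ : E → F → ℝ} {gx : E → F → E} {gy : E → F → F}

/-- The dual part `(y + d) / 2` of the proximal point. -/
noncomputable def proxPoint (C zb : Pt E F) : Pt E F :=
  pair zb.fst ((1 / 2 : ℝ) • (zb.snd + C.snd))

/-- The proximal point with its dual part corrected for the inexactness of the subproblem. -/
noncomputable def proxNext (τ : ℝ) (C z₀ zT zb : Pt E F) : Pt E F :=
  pair zb.fst ((1 / 2 : ℝ) • (zb.snd + C.snd) - (2 * τ) • (z₀.snd - zT.snd))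

/-- The (negative) approximate gradient at the proximal point. -/
noncomputable def proxGrad (b τ : ℝ) (C z₀ zT zb : Pt E F) : Pt E F :=
  b • (proxPoint C zb - C - pair ((2 * τ) • (z₀.fst - zT.fst)) 0)

/-- The error made in a proximal step. -/
noncomputable def proxErr (b τ : ℝ) (C z₀ zT zb : Pt E F) : ℝ :=
  τ * b * (‖z₀.fst - zb.fst‖ ^ 2 - ‖zT.fst - zb.fst‖ ^ 2)
    - τ * b * inner ℝ (z₀.snd - zT.snd) (zb.snd + C.snd - z₀.snd - zT.snd)
    + 2 * τ ^ 2 * b * ‖z₀.snd - zT.snd‖ ^ 2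

/-- An inexact subgradient inequality for `(x, s) ↦ max_y φ(x, y) + (b / 2) ‖y - s‖²`. -/
theorem ProxBound.subgradient {τ : ℝ} {C z₀ zT zb : Pt E F}
    (hA : ProxBound X Y a b τ φ C z₀ zT zb) {ξ : Pt E F} (hx : ξ.fst ∈ X) {y : F} (hy : y ∈ Y) :
    φ zb.fst y + b / 2 * ‖y - (proxNext τ C z₀ zT zb).snd‖ ^ 2 ≤
      φ ξ.fst zb.snd + b / 2 * ‖zb.snd - ξ.snd‖ ^ 2
        - inner ℝ (proxGrad b τ C z₀ zT zb) (proxPoint C zb - ξ)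
        - a / 2 * ‖(proxPoint C zb).fst - ξ.fst‖ ^ 2 - b / 2 * ‖(proxPoint C zb).snd - ξ.snd‖ ^ 2
        + proxErr b τ C z₀ zT zb := by
  -- The difference of squares on the right of `ProxBound` is affine in the test point. Its part in
  -- `y` moves the dual center to `proxNext`, its part in `x` perturbs `proxGrad`, and the constants
  -- form `proxErr`.
  have h := hA _ hx _ hy
  rw [norm_sq_pt, norm_sq_pt (zT - _)] at h
  simp only [inner_pt, proxNext, proxErr, proxGrad, proxPoint, pair_fst, pair_snd, WithLp.sub_fst,
    WithLp.sub_snd, ← real_inner_self_eq_norm_sq,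
    inner_add_left, inner_sub_left, inner_sub_right, inner_add_right, real_inner_smul_left,
    real_inner_smul_right, inner_zero_left] at *
  have c := fun x y : E => real_inner_comm x y
  have c' := fun x y : F => real_inner_comm x y
  simp only [c ξ.fst zb.fst, c z₀.fst zb.fst, c zT.fst zb.fst, c ξ.fst z₀.fst,
    c ξ.fst zT.fst, c' y zb.snd, c' C.snd zb.snd, c' z₀.snd zb.snd, c' zT.snd zb.snd,
    c' ξ.snd zb.snd, c' y z₀.snd, c' y zT.snd, c' y C.snd, c' C.snd z₀.snd, c' C.snd zT.snd,
    c' zT.snd z₀.snd, c' ξ.snd C.snd] at h ⊢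
  linarith

/-- The distances in an inexact proximal step, relative to the distance `ρ` of the center to the
exact solution `zp`. -/
structure ProxClose (ρ : ℝ) (C z₀ zT zb zp : Pt E F) : Prop where
  center : ‖C - zp‖ = ρ
  start : ‖z₀ - zp‖ ≤ ρ
  final : ‖zT - zp‖ ≤ ρ
  average : ‖zb - zp‖ ≤ ρ / 20
  projection : ‖C - z₀‖ ≤ ρ

namespace ProxClose

variable {ρ τ : ℝ} {C z₀ zT zb zp : Pt E F}

theorem dist_center (h : ProxClose ρ C z₀ zT zb zp) :
    19 / 20 * ρ ≤ ‖zb - C‖ ∧ ‖zb - C‖ ≤ 21 / 20 * ρ := by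
  have h1 := h.center
  have h2 := h.average
  have e1 : C - zp = (zb - zp) - (zb - C) := by abel
  have e2 : zb - C = (zb - zp) - (C - zp) := by abel
  constructor
  · have := norm_sub_le (zb - zp) (zb - C)
    rw [← e1] at this; linarith
  · have := norm_sub_le (zb - zp) (C - zp)
    rw [← e2] at this; linarith

theorem proxPoint_sub (C zb : Pt E F) :
    ‖proxPoint C zb - C‖ ^ 2 = ‖zb.fst - C.fst‖ ^ 2 + 1 / 4 * ‖zb.snd - C.snd‖ ^ 2 := by
  have e : (proxPoint C zb - C).snd = (1 / 2 : ℝ) • (zb.snd - C.snd) := by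
    simp only [proxPoint, WithLp.sub_snd, pair_snd]; module
  rw [norm_sq_pt, e, norm_smul, Real.norm_of_nonneg (by norm_num : (0 : ℝ) ≤ 1 / 2), mul_pow]
  norm_num [proxPoint]

/-- Halving the dual displacement loses at most a factor 4 in the square, and `(19/20)²/4 ≥ 9/40`.
-/
theorem dist_proxPoint (h : ProxClose ρ C z₀ zT zb zp) :
    9 / 40 * ρ ^ 2 ≤ ‖proxPoint C zb - C‖ ^ 2 ∧ ‖proxPoint C zb - C‖ ≤ 21 / 20 * ρ := by
  have hρ : 0 ≤ ρ := h.center ▸ norm_nonneg _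
  obtain ⟨h1, h2⟩ := h.dist_center
  have h3 := pow_le_pow_left₀ (by positivity) h1 2
  have h4 := norm_sq_pt (zb - C)
  rw [WithLp.sub_fst, WithLp.sub_snd] at h4
  have h5 := proxPoint_sub C zb
  constructor
  · nlinarith [sq_nonneg ‖zb.fst - C.fst‖]
  · refine le_trans (le_of_sq_le_sq ?_ (norm_nonneg _)) h2
    nlinarith [sq_nonneg ‖zb.snd - C.snd‖]

theorem norm_perturbation_le (h : ProxClose ρ C z₀ zT zb zp) (hτ : 0 ≤ τ) (hτ' : τ ≤ 1 / 800) :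
    ‖pair (F := F) ((2 * τ) • (z₀.fst - zT.fst)) 0‖ ≤ ρ / 200 := by
  have e : ‖pair (F := F) ((2 * τ) • (z₀.fst - zT.fst)) 0‖ = 2 * τ * ‖z₀.fst - zT.fst‖ := by
    rw [pair, WithLp.norm_toLp_fst, norm_smul, Real.norm_of_nonneg (by positivity)]
  have h1 : ‖z₀.fst - zT.fst‖ ≤ 2 * ρ := by
    have := norm_fst_le (z₀ - zT)
    have e2 : z₀ - zT = (z₀ - zp) - (zT - zp) := by abel
    have h3 := norm_sub_le (z₀ - zp) (zT - zp)
    rw [← e2] at h3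
    rw [WithLp.sub_fst] at this
    linarith [h.start, h.final]
  rw [e]
  nlinarith [norm_nonneg (z₀.fst - zT.fst)]

/-- Every term of `proxErr` carries a factor `τ` times a product of two lengths of order `ρ`. -/
theorem proxErr_le (h : ProxClose ρ C z₀ zT zb zp) (hb : 0 ≤ b) (hτ : 0 ≤ τ) (hτ' : τ ≤ 1 / 800) :
    proxErr b τ C z₀ zT zb ≤ b * (ρ ^ 2 / 100) := by
  have hρ : 0 ≤ ρ := h.center ▸ norm_nonneg _
  have h1 : ‖z₀.fst - zb.fst‖ ≤ 21 / 20 * ρ := by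
    have h2 := norm_fst_le (z₀ - zb)
    have e : z₀ - zb = (z₀ - zp) - (zb - zp) := by abel
    have h3 := norm_sub_le (z₀ - zp) (zb - zp)
    rw [← e] at h3
    rw [WithLp.sub_fst] at h2
    linarith [h.start, h.average]
  have h2 : ‖z₀.snd - zT.snd‖ ≤ 2 * ρ := by
    have h2 := norm_snd_le (z₀ - zT)
    have e : z₀ - zT = (z₀ - zp) - (zT - zp) := by abel
    have h3 := norm_sub_le (z₀ - zp) (zT - zp)
    rw [← e] at h3
    rw [WithLp.sub_snd] at h2
    linarith [h.start, h.final]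
  have h3 : ‖zb.snd + C.snd - z₀.snd - zT.snd‖ ≤ 41 / 20 * ρ := by
    have h2 := norm_snd_le ((zb - zp) - (zT - zp) + (C - z₀))
    have h3 := norm_add_le ((zb - zp) - (zT - zp)) (C - z₀)
    have h4 := norm_sub_le (zb - zp) (zT - zp)
    have e : ((zb - zp) - (zT - zp) + (C - z₀)).snd = zb.snd + C.snd - z₀.snd - zT.snd := by
      simp only [WithLp.sub_snd, WithLp.add_snd]; abel
    rw [e] at h2
    linarith [h.final, h.average, h.projection]
  have h4 : -inner ℝ (z₀.snd - zT.snd) (zb.snd + C.snd - z₀.snd - zT.snd) ≤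
      2 * ρ * (41 / 20 * ρ) :=
    (neg_le_abs _).trans ((abs_real_inner_le_norm _ _).trans
      (mul_le_mul h2 h3 (norm_nonneg _) (by positivity)))
  have h5 := pow_le_pow_left₀ (norm_nonneg _) h1 2
  have h6 := pow_le_pow_left₀ (norm_nonneg _) h2 2
  have h7 : τ * (‖z₀.fst - zb.fst‖ ^ 2 - ‖zT.fst - zb.fst‖ ^ 2) ≤ 1 / 800 * (21 / 20 * ρ) ^ 2 :=
    (mul_le_mul_of_nonneg_left (by linarith [sq_nonneg ‖zT.fst - zb.fst‖]) hτ).trans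
      (mul_le_mul_of_nonneg_right hτ' (by positivity))
  have h8 : τ * -inner ℝ (z₀.snd - zT.snd) (zb.snd + C.snd - z₀.snd - zT.snd) ≤
      1 / 800 * (2 * ρ * (41 / 20 * ρ)) :=
    (mul_le_mul_of_nonneg_left h4 hτ).trans (mul_le_mul_of_nonneg_right hτ' (by positivity))
  have h9 : 2 * τ ^ 2 * ‖z₀.snd - zT.snd‖ ^ 2 ≤ 2 * (1 / 800) ^ 2 * (2 * ρ) ^ 2 := by
    gcongr
  rw [proxErr]
  have : τ * (‖z₀.fst - zb.fst‖ ^ 2 - ‖zT.fst - zb.fst‖ ^ 2)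
    + τ * -inner ℝ (z₀.snd - zT.snd) (zb.snd + C.snd - z₀.snd - zT.snd)
    + 2 * τ ^ 2 * ‖z₀.snd - zT.snd‖ ^ 2 ≤ ρ ^ 2 / 100 := by nlinarith [sq_nonneg ρ]
  have := mul_le_mul_of_nonneg_left this hb
  linarith

theorem inner_proxGrad_nonneg (h : ProxClose ρ C z₀ zT zb zp) (hb : 0 ≤ b) (hτ : 0 ≤ τ)
    (hτ' : τ ≤ 1 / 800) : 0 ≤ inner ℝ (proxGrad b τ C z₀ zT zb) (proxPoint C zb - C) := by
  have hρ : 0 ≤ ρ := h.center ▸ norm_nonneg _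
  have h1 := h.dist_proxPoint
  have h2 := h.norm_perturbation_le hτ hτ'
  rw [proxGrad, real_inner_smul_left, inner_sub_left, real_inner_self_eq_norm_sq]
  have h3 := (real_inner_le_norm (pair (F := F) ((2 * τ) • (z₀.fst - zT.fst)) 0)
    (proxPoint C zb - C)).trans (mul_le_mul h2 h1.2 (norm_nonneg _) (by positivity))
  refine mul_nonneg hb ?_
  nlinarith [h1.1]

/-- The error of a proximal step is compensated by its length. -/
theorem error_compensated (h : ProxClose ρ C z₀ zT zb zp) (hb : 0 < b) (hτ : 0 ≤ τ)
    (hτ' : τ ≤ 1 / 800) :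
    -(1 / 2) * inner ℝ (proxGrad b τ C z₀ zT zb) (proxPoint C zb - C)
      + 1 / (4 * b) * ‖proxGrad b τ C z₀ zT zb‖ ^ 2 + proxErr b τ C z₀ zT zb ≤ 0 := by
  have hρ : 0 ≤ ρ := h.center ▸ norm_nonneg _
  have h1 := h.dist_proxPoint
  have h2 := pow_le_pow_left₀ (norm_nonneg _) (h.norm_perturbation_le hτ hτ') 2
  have h3 := h.proxErr_le hb.le hτ hτ'
  rw [proxGrad, norm_smul, Real.norm_of_nonneg hb.le, real_inner_smul_left]
  set Δ := proxPoint C zb - C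
  set p := pair (F := F) ((2 * τ) • (z₀.fst - zT.fst)) 0
  have e : -(1 / 2) * (b * inner ℝ (Δ - p) Δ) + 1 / (4 * b) * (b * ‖Δ - p‖) ^ 2 =
      b * (-(1 / 4) * ‖Δ‖ ^ 2 + 1 / 4 * ‖p‖ ^ 2) := by
    rw [mul_pow, norm_sub_sq_real, inner_sub_left, real_inner_self_eq_norm_sq, real_inner_comm p Δ]
    field_simp
    ring
  rw [e]
  -- In units of `ρ²`: the step contributes at least `9/160`, against `1/160000` from `p` and
  -- `1/100` from the error.
  have : -(1 / 4) * ‖Δ‖ ^ 2 + 1 / 4 * ‖p‖ ^ 2 + ρ ^ 2 / 100 ≤ 0 := by nlinarith [h1.1]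
  nlinarith

theorem norm_proxGrad_le (h : ProxClose ρ C z₀ zT zb zp) (hb : 0 ≤ b) (hτ : 0 ≤ τ)
    (hτ' : τ ≤ 1 / 800) : ‖proxGrad b τ C z₀ zT zb‖ ≤ b * (2 * ρ) := by
  have hρ : 0 ≤ ρ := h.center ▸ norm_nonneg _
  rw [proxGrad, norm_smul, Real.norm_of_nonneg hb]
  refine mul_le_mul_of_nonneg_left ((norm_sub_le _ _).trans ?_) hb
  linarith [h.dist_proxPoint.2, h.norm_perturbation_le hτ hτ']

end ProxClose

/-- The potential of the accelerated method at the pair `(ξ, v)` is at most `R`. -/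
def PotentialLE (X : Set E) (Y : Set F) (a b : ℝ) (φ : E → F → ℝ) (zs : Pt E F) (R : ℝ)
    (s : Pt E F × Pt E F) : Prop :=
  s.1.fst ∈ X ∧ ∀ y ∈ Y, φ s.1.fst y + b / 2 * ‖y - s.1.snd‖ ^ 2 - φ zs.fst zs.snd
    + a / 2 * ‖s.2 - zs‖ ^ 2 ≤ R

/-- `zs` is the saddle point of `φ`. -/
def IsSaddlePoint (X : Set E) (Y : Set F) (gx : E → F → E) (gy : E → F → F)
    (zs : feasible X Y) : Prop :=
  ∀ u : feasible X Y, 0 ≤ inner ℝ (saddleOp gx gy zs) ((u : Pt E F) - zs)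

/-- First-order optimality combined with the strong convexity and concavity. The second half says
that `Ψ`, the maximum over `y` of `φ(x, y) + (b/2)‖y - s‖²`, takes the value `φ(x*, y*)` at `(x*,
y*)`. -/
theorem IsSaddlePoint.gap (h : IsSaddle X Y a b l φ gx gy) {zs : feasible X Y}
    (hzs : IsSaddlePoint X Y gx gy zs) :
    (∀ x ∈ X, φ (zs : Pt E F).fst (zs : Pt E F).snd + a / 2 * ‖x - (zs : Pt E F).fst‖ ^ 2 ≤
      φ x (zs : Pt E F).snd) ∧
    (∀ y ∈ Y, φ (zs : Pt E F).fst y + b / 2 * ‖y - (zs : Pt E F).snd‖ ^ 2 ≤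
      φ (zs : Pt E F).fst (zs : Pt E F).snd) := by
  obtain ⟨zs, hm⟩ := zs
  constructor
  · intro x hx
    have h1 := hzs ⟨pair x zs.snd, hx, hm.2⟩
    have h2 := h.convex _ hm.1 _ hx _ hm.2
    simp only [inner_pt, saddleOp, pair_fst, pair_snd, WithLp.sub_fst, WithLp.sub_snd, sub_self,
      inner_zero_right, add_zero] at h1
    change _ ≤ φ x zs.snd
    change φ zs.fst zs.snd + _ ≤ _
    linarith
  · intro y hy
    have h1 := hzs ⟨pair zs.fst y, hm.1, hy⟩
    have h2 := h.concave _ hm.1 _ hm.2 _ hy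
    simp only [inner_pt, saddleOp, pair_fst, pair_snd, WithLp.sub_fst, WithLp.sub_snd, sub_self,
      inner_zero_right, zero_add, inner_neg_left] at h1
    change _ ≤ φ zs.fst zs.snd
    change φ zs.fst y + _ ≤ _
    linarith

/-- The update of the accelerated proximal point method. -/
noncomputable def accelUpdate (a b τ θ : ℝ) (C v z₀ zT zb : Pt E F) : Pt E F × Pt E F :=
  (proxNext τ C z₀ zT zb,
    (1 - θ) • v + θ • proxPoint C zb + (θ / a) • proxGrad b τ C z₀ zT zb)

/-- The extrapolated center of the accelerated proximal point method. -/
noncomputable def accelCenter (θ : ℝ) (s : Pt E F × Pt E F) : Pt E F :=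
  (1 + θ)⁻¹ • (s.1 + θ • s.2)

theorem norm_sq_convex_comb_le {H : Type*} [NormedAddCommGroup H] [InnerProductSpace ℝ H]
    {θ : ℝ} (h0 : 0 ≤ θ) (h1 : θ ≤ 1) (p q : H) :
    ‖(1 - θ) • p + θ • q‖ ^ 2 ≤ (1 - θ) * ‖p‖ ^ 2 + θ * ‖q‖ ^ 2 := by
  have h : 0 ≤ (1 - θ) * θ * ‖p - q‖ ^ 2 :=
    mul_nonneg (mul_nonneg (by linarith) h0) (sq_nonneg _)
  simp only [← real_inner_self_eq_norm_sq, inner_add_left, inner_add_right, inner_sub_left,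
    inner_sub_right, real_inner_smul_left, real_inner_smul_right, real_inner_comm p q] at *
  nlinarith

/-- Nesterov's estimate: the subgradient inequality at the old point with weight `1 - θ` and at `zs`
with weight `θ`, together with the expansion of the new distance from `v` to `zs`. -/
theorem PotentialLE.step (h : IsSaddle X Y a b l φ gx gy) (ha : 0 < a) (hab : a ≤ b)
    {zs : feasible X Y} (hzs : IsSaddlePoint X Y gx gy zs) {R θ τ ρ : ℝ}
    {s : Pt E F × Pt E F} (hs : PotentialLE X Y a b φ zs R s)
    (hθ : 0 ≤ θ) (hθ2 : θ ^ 2 = a / (2 * b)) (hτ : 0 ≤ τ) (hτ' : τ ≤ 1 / 800)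
    {z₀ zT zb zp : Pt E F} (hzb : zb ∈ feasible X Y)
    (hA : ProxBound X Y a b τ φ (accelCenter θ s) z₀ zT zb)
    (hc : ProxClose ρ (accelCenter θ s) z₀ zT zb zp) :
    PotentialLE X Y a b φ zs ((1 - θ) * R)
      (accelUpdate a b τ θ (accelCenter θ s) s.2 z₀ zT zb) := by
  obtain ⟨zs, hzm⟩ := zs
  have hb : 0 < b := ha.trans_le hab
  have hθ3 : θ ^ 2 ≤ 1 / 2 := by
    rw [hθ2, div_le_iff₀ (by positivity)]; linarith
  have hθ1 : θ ≤ 1 := by nlinarith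
  refine ⟨hzb.1, fun y hy => ?_⟩
  obtain ⟨ξ, v⟩ := s
  set C := accelCenter θ (ξ, v) with hC
  have hCξ : (1 + θ) • C = ξ + θ • v := by
    rw [hC, accelCenter, smul_smul, mul_inv_cancel₀ (by positivity), one_smul]
  have g1 := hA.subgradient (ξ := ξ) hs.1 hy
  have g2 := hA.subgradient (ξ := zs) hzm.1 hy
  -- The subgradient inequality bounds by the value at `y = zb.snd` only; taking that `y` in the old
  -- potential and in the saddle gap closes the estimate.
  have g3 := hs.2 _ hzb.2
  have g4 := (hzs.gap h).2 _ hzb.2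
  have g5 := hc.inner_proxGrad_nonneg hb.le hτ hτ'
  have g6 := hc.error_compensated hb hτ hτ'
  simp only [accelUpdate] at *
  set G := proxGrad b τ C z₀ zT zb
  set ξb := proxPoint C zb
  set s' := proxNext τ C z₀ zT zb
  set err := proxErr b τ C z₀ zT zb
  have e1 : (1 - θ) • v + θ • ξb + (θ / a) • G - zs =
      ((1 - θ) • (v - zs) + θ • (ξb - zs)) + (θ / a) • G := by module
  set U := (1 - θ) • (v - zs) + θ • (ξb - zs) with hU
  -- The choice `θ² = a / (2b)` turns `θ² / (2a)` into the coefficient `1 / (4b)` of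
  -- `error_compensated`.
  have e2 : a / 2 * ‖U + (θ / a) • G‖ ^ 2 =
      a / 2 * ‖U‖ ^ 2 + θ * inner ℝ G U + 1 / (4 * b) * ‖G‖ ^ 2 := by
    rw [norm_add_sq_real, norm_smul, mul_pow, Real.norm_eq_abs, sq_abs, div_pow, hθ2,
      real_inner_smul_right, real_inner_comm]
    field_simp
    ring
  have e3 : ‖U‖ ^ 2 ≤ (1 - θ) * ‖v - zs‖ ^ 2 + θ * ‖ξb - zs‖ ^ 2 :=
    norm_sq_convex_comb_le hθ hθ1 _ _
  -- The center `C` is chosen so that all inner products with `G` collapse to one with `ξb - C`.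
  -- Since `θ² ≤ 1/2`, at least half of it remains to pay for the errors.
  have e4 : (1 - θ) * inner ℝ G (ξb - ξ) + θ * inner ℝ G (ξb - zs) - θ * inner ℝ G U =
      (1 - θ ^ 2) * inner ℝ G (ξb - C) := by
    have : (1 - θ) • (ξb - ξ) + θ • (ξb - zs) - θ • U = (1 - θ ^ 2) • (ξb - C) := by
      have e : (1 - θ ^ 2) • C = (1 - θ) • (ξ + θ • v) := by
        rw [← hCξ, smul_smul]; congr 1; ring
      rw [smul_sub (1 - θ ^ 2), e, hU]
      module
    rw [← real_inner_smul_right, ← real_inner_smul_right, ← real_inner_smul_right,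
      ← real_inner_smul_right, ← this, inner_sub_right, inner_add_right]
  have e5 := norm_sq_pt (ξb - zs)
  rw [WithLp.sub_fst, WithLp.sub_snd] at e5
  rw [e1, e2]
  have k1 := mul_le_mul_of_nonneg_left g1 (by linarith : 0 ≤ 1 - θ)
  have k2 := mul_le_mul_of_nonneg_left g2 hθ
  have k3 := mul_le_mul_of_nonneg_left g3 (by linarith : 0 ≤ 1 - θ)
  have k4 := mul_le_mul_of_nonneg_left g4 hθ
  have k5 := mul_le_mul_of_nonneg_left e3 (by positivity : 0 ≤ a / 2)
  -- The dual modulus is `b`, but the potential only uses `a` in both variables; this is where `a ≤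
  -- b` enters.
  have k6 : 0 ≤ θ * ((b - a) / 2 * ‖ξb.snd - zs.snd‖ ^ 2) :=
    mul_nonneg hθ (mul_nonneg (by linarith) (sq_nonneg _))
  have k7 : 0 ≤ (1 - θ) * (a / 2 * ‖ξb.fst - ξ.fst‖ ^ 2 + b / 2 * ‖ξb.snd - ξ.snd‖ ^ 2) :=
    mul_nonneg (by linarith) (by positivity)
  have k8 : 0 ≤ (1 / 2 - θ ^ 2) * inner ℝ G (ξb - C) := mul_nonneg (by linarith) g5
  have e6 : s'.fst = zb.fst := rfl
  rw [e6]
  rw [e5] at k5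
  linarith

theorem PotentialLE.init (h : IsSaddle X Y a b l φ gx gy) (ha : 0 < a) (hab : a ≤ b)
    {zs : feasible X Y} (hzs : IsSaddlePoint X Y gx gy zs) {τ ρ D : ℝ}
    (hτ : 0 ≤ τ) (hτ' : τ ≤ 1 / 800)
    {C z₀ zT zb zp : Pt E F} (hzb : zb ∈ feasible X Y)
    (hA : ProxBound X Y a b τ φ C z₀ zT zb) (hc : ProxClose ρ C z₀ zT zb zp)
    (hρ : ρ ≤ D) (hC : ‖C - zs‖ ≤ D) :
    PotentialLE X Y a b φ zs (20 * b * D ^ 2) (proxNext τ C z₀ zT zb, C) := by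
  have hρ0 : 0 ≤ ρ := hc.center ▸ norm_nonneg _
  have hb : 0 < b := ha.trans_le hab
  have hD : 0 ≤ D := hρ0.trans hρ
  refine ⟨hzb.1, fun y hy => ?_⟩
  have g2 := hA.subgradient (ξ := zs) zs.2.1 hy
  have g4 := (hzs.gap h).2 _ hzb.2
  have g5 := hc.norm_proxGrad_le hb.le hτ hτ'
  have g6 := hc.proxErr_le hb.le hτ hτ'
  have g7 : ‖proxPoint C zb - zs‖ ≤ 3 * D := by
    have e : proxPoint C zb - zs = (proxPoint C zb - C) + (C - zs) := by abel
    rw [e]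
    linarith [norm_add_le (proxPoint C zb - C) (C - zs), hc.dist_proxPoint.2]
  have g8 : -inner ℝ (proxGrad b τ C z₀ zT zb) (proxPoint C zb - zs) ≤ b * (2 * D) * (3 * D) := by
    refine (neg_le_abs _).trans ((abs_real_inner_le_norm _ _).trans
      (mul_le_mul (g5.trans ?_) g7 (norm_nonneg _) (by positivity)))
    gcongr
  have g9 := pow_le_pow_left₀ (norm_nonneg _) hC 2
  have g10 := pow_le_pow_left₀ hρ0 hρ 2
  have k1 : 0 ≤ a / 2 * ‖(proxPoint C zb).fst - (zs : Pt E F).fst‖ ^ 2 := by positivity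
  have k2 : 0 ≤ b / 2 * ‖(proxPoint C zb).snd - (zs : Pt E F).snd‖ ^ 2 := by positivity
  have k3 : a / 2 * ‖C - zs‖ ^ 2 ≤ b / 2 * D ^ 2 :=
    mul_le_mul (by linarith) g9 (sq_nonneg _) (by positivity)
  have k4 := mul_le_mul_of_nonneg_left g10 hb.le
  have e6 : (proxNext τ C z₀ zT zb).fst = zb.fst := rfl
  simp only [e6]
  nlinarith [mul_nonneg hb.le (sq_nonneg D)]

theorem PotentialLE.norm_sub_sq_le (h : IsSaddle X Y a b l φ gx gy) (hab : a ≤ b)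
    {zs : feasible X Y} (hzs : IsSaddlePoint X Y gx gy zs) {R : ℝ} (ha : 0 < a)
    {s : Pt E F × Pt E F} (hs : PotentialLE X Y a b φ zs R s) :
    a / 2 * ‖s.1 - zs‖ ^ 2 ≤ R := by
  have h1 := hs.2 _ zs.2.2
  have h2 := (hzs.gap h).1 _ hs.1
  have h3 : 0 ≤ a / 2 * ‖s.2 - zs‖ ^ 2 := by positivity
  rw [norm_sq_pt, WithLp.sub_fst, WithLp.sub_snd, norm_sub_rev s.1.snd]
  have h4 : 0 ≤ (b - a) / 2 * ‖(zs : Pt E F).snd - s.1.snd‖ ^ 2 :=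
    mul_nonneg (by linarith) (sq_nonneg _)
  linarith

end Accelerated

/-! ### Saddle point solver with `O(l / √(ab))` queries up to a logarithm -/

section Solver

variable {E F : Type*} [NormedAddCommGroup E] [InnerProductSpace ℝ E]
  [NormedAddCommGroup F] [InnerProductSpace ℝ F]
  {X : Set E} {Y : Set F} {a b l : ℝ} {φ : E → F → ℝ} {gx : E → F → E} {gy : E → F → F}

/-- The oracle answering with the operator `(∂ₓφ, -∂_yφ)`. -/
abbrev saddleOracle (X : Set E) (Y : Set F) (gx : E → F → E) (gy : E → F → F) :
    feasible X Y → Pt E F := fun z => saddleOp gx gy z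

theorem isCompact_feasible (hX : IsCompact X) (hY : IsCompact Y) : IsCompact (feasible X Y) := by
  have h := (hX.prod hY).image (WithLp.prod_continuous_toLp 2 E F)
  convert h using 1
  ext z
  constructor
  · intro hz
    exact ⟨(z.fst, z.snd), ⟨hz.1, hz.2⟩, rfl⟩
  · rintro ⟨w, hw, rfl⟩
    exact hw

/-- `z` solves the variational inequality of the operator `V` up to `ε`. -/
def IsApproxSolution {H : Type*} [NormedAddCommGroup H] [InnerProductSpace ℝ H] {K : Set H}
    (V : K → H) (ε : ℝ) (z : K) : Prop :=
  ∀ u : K, inner ℝ (V z) ((z : H) - u) ≤ ε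

/-- The procedure for the proximal subproblem with center `C`. -/
noncomputable def proxProc (P : Pt E F → feasible X Y) (b l : ℝ) (T : ℕ) (C : Pt E F) :
    OracleProc (feasible X Y) (Pt E F) (feasible X Y × Pt E F) :=
  extragradient P (l + b)⁻¹ (proxReg b C) T C

/-- The accuracy is relative to the distance from the center to the exact solution, so `T` does not
depend on the target accuracy. The center may be infeasible, as extrapolation leaves `X × Y`; the
extragradient steps start from its projection. -/
theorem proxProc_run (h : IsSaddle X Y a b l φ gx gy) (ha : 0 ≤ a) (hb : 0 < b) (hl : 0 ≤ l)
    (hXc : Convex ℝ X) (hYc : Convex ℝ Y) (hK : IsCompact (feasible X Y))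
    {P : Pt E F → feasible X Y} (hP : IsProj P) {T : ℕ} (hT : 400 * (l + b) / b ≤ T)
    (C : Pt E F) :
    ∃ zp : feasible X Y,
      ((proxProc P b l T C).run (saddleOracle X Y gx gy)).2 ∈ feasible X Y ∧
      ProxBound X Y a b ((l + b) / (2 * T * b)) φ C (P C)
        ((proxProc P b l T C).run (saddleOracle X Y gx gy)).1
        ((proxProc P b l T C).run (saddleOracle X Y gx gy)).2 ∧
      ProxClose ‖C - zp‖ C (P C)
        ((proxProc P b l T C).run (saddleOracle X Y gx gy)).1
        ((proxProc P b l T C).run (saddleOracle X Y gx gy)).2 zp := by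
  have hlb : 0 < l + b := by positivity
  have hT0 : (0 : ℝ) < T := lt_of_lt_of_le (by positivity) hT
  obtain ⟨zp, hzp⟩ := hP.exists_solution ⟨_, (P 0).2⟩ hK
    (V := fun z => saddleOp gx gy z + proxReg b C z) (half_pos hb) (h.prox_lip hb C)
    fun z w => le_trans (by
      rw [norm_sq_pt, mul_add, WithLp.sub_fst, WithLp.sub_snd]
      gcongr
      linarith) (h.prox_strongly_monotone C z w)
  obtain ⟨t, h1, h2⟩ := extragradient_run hP (o := saddleOracle X Y gx gy)
    (inv_nonneg.2 hlb.le) (inv_mul_cancel₀ hlb.ne').le (h.prox_lip hb C) T C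
  obtain ⟨h3, h4⟩ := h.proxBound_average ha hb hXc hYc (inv_pos.2 hlb) (by exact_mod_cast hT0) h1 h2
  have e : 1 / (2 * (l + b)⁻¹ * T * b) = (l + b) / (2 * T * b) := by field_simp
  rw [e] at h4
  refine ⟨zp, h3, h4, ?_⟩
  have h5 := h4.norm_sub_sq_le h ha hb h3 hzp
  set τ := (l + b) / (2 * T * b)
  have hτ0 : 0 < τ := by positivity
  have hτ : τ ≤ 1 / 800 := by
    rw [div_le_iff₀ hb] at hT
    rw [div_le_iff₀ (by positivity)]
    linarith
  change ProxClose _ _ _ ((extragradient P (l + b)⁻¹ (proxReg b C) T C).run _).1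
    ((extragradient P (l + b)⁻¹ (proxReg b C) T C).run _).2 _
  set r := (extragradient P (l + b)⁻¹ (proxReg b C) T C).run (saddleOracle X Y gx gy)
  have h6 : ‖(P C : Pt E F) - zp‖ ≤ ‖C - zp‖ := hP.norm_sub_coe_le _ _
  refine ⟨rfl, h6, ?_, ?_, hP.norm_self_sub_le _ _⟩
  · refine le_trans (le_of_sq_le_sq ?_ (norm_nonneg _)) h6
    have : 0 ≤ 2 * τ * (‖(P C : Pt E F) - zp‖ ^ 2 - ‖(r.1 : Pt E F) - zp‖ ^ 2) :=
      (sq_nonneg _).trans h5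
    have := nonneg_of_mul_nonneg_right this (by positivity)
    linarith
  -- `2τ ≤ 1/400 = (1/20)²`.
  · refine le_of_sq_le_sq (h5.trans ?_) (by positivity)
    have h7 := pow_le_pow_left₀ (norm_nonneg _) h6 2
    have h8 : 2 * τ * (‖(P C : Pt E F) - zp‖ ^ 2 - ‖(r.1 : Pt E F) - zp‖ ^ 2) ≤
        2 * (1 / 800) * ‖C - zp‖ ^ 2 := by
      have h9 : ‖(P C : Pt E F) - zp‖ ^ 2 - ‖(r.1 : Pt E F) - zp‖ ^ 2 ≤ ‖C - zp‖ ^ 2 := by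
        linarith [sq_nonneg ‖(r.1 : Pt E F) - zp‖]
      exact (mul_le_mul_of_nonneg_left h9 (by positivity)).trans (by gcongr)
    linarith

/-- One step of the accelerated proximal point method. -/
noncomputable def accelStep (P : Pt E F → feasible X Y) (a b l τ θ : ℝ) (T : ℕ)
    (s : Pt E F × Pt E F) : OracleProc (feasible X Y) (Pt E F) (Pt E F × Pt E F) :=
  (proxProc P b l T (accelCenter θ s)).bind fun r =>
    .output (accelUpdate a b τ θ (accelCenter θ s) s.2 (P (accelCenter θ s)) r.1 r.2)

/-- The accelerated proximal point method with `N` steps, followed by a projected step. -/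
noncomputable def saddleSolver (P : Pt E F → feasible X Y) (a b l τ θ : ℝ) (T N : ℕ)
    (C : Pt E F) : OracleProc (feasible X Y) (Pt E F) (feasible X Y) :=
  (proxProc P b l T C).bind fun r =>
    (OracleProc.loop (accelStep P a b l τ θ T) N (proxNext τ C (P C) r.1 r.2, C)).bind fun s =>
      .query (P s.1) fun v => .output (P (P s.1 - l⁻¹ • v))

theorem cost_saddleSolver_le (P : Pt E F → feasible X Y) (a b l τ θ : ℝ) (T N : ℕ) (C : Pt E F)
    (o : feasible X Y → Pt E F) :
    (saddleSolver P a b l τ θ T N C).cost o ≤ 2 * T * (N + 1) + 1 := by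
  have h1 : ∀ C, (proxProc P b l T C).cost o ≤ T * 2 := fun C => cost_extragradient_le _ _ _ _ _ _
  have h2 : ∀ s, (accelStep P a b l τ θ T s).cost o ≤ T * 2 := by
    intro s
    rw [accelStep, OracleProc.cost_bind]
    exact h1 _
  rw [saddleSolver, OracleProc.cost_bind, OracleProc.cost_bind]
  have h3 := OracleProc.cost_loop_le o (accelStep P a b l τ θ T) h2 N
    (proxNext τ C (P C) ((proxProc P b l T C).run o).1 ((proxProc P b l T C).run o).2, C)
  have h4 := h1 C
  simp only [OracleProc.cost]
  nlinarith

/-- The potential after `N` steps bounds the squared distance `r²` to the saddle point by `(2/a) (1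
- θ)^N 20bD²`, and the projected step turns it into the residual `6lrD`; `1440 = 36 · 40`. -/
theorem saddleSolver_run (h : IsSaddle X Y a b l φ gx gy) (ha : 0 < a) (hab : a ≤ b)
    (hl : 0 < l) (hXc : Convex ℝ X) (hYc : Convex ℝ Y) (hK : IsCompact (feasible X Y))
    {P : Pt E F → feasible X Y} (hP : IsProj P) {T N : ℕ} (hT : 400 * (l + b) / b ≤ T)
    {θ D ε : ℝ} (hθ : 0 ≤ θ) (hθ2 : θ ^ 2 = a / (2 * b))
    (hD : ∀ u w : feasible X Y, ‖(u : Pt E F) - w‖ ≤ D) (hε : 0 ≤ ε)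
    (hN : (1 - θ) ^ N * (1440 * l ^ 2 * b * D ^ 4 / a) ≤ ε ^ 2) (C : feasible X Y) :
    IsApproxSolution (saddleOracle X Y gx gy) ε
      ((saddleSolver P a b l ((l + b) / (2 * T * b)) θ T N C).run (saddleOracle X Y gx gy)) := by
  have hb : 0 < b := ha.trans_le hab
  obtain ⟨zs, hzs⟩ : ∃ zs : feasible X Y, IsSaddlePoint X Y gx gy zs :=
    hP.exists_solution ⟨_, (P 0).2⟩ hK (V := fun z => saddleOp gx gy z) ha h.lip
      fun z w => le_trans (by
        rw [norm_sq_pt, mul_add, WithLp.sub_fst, WithLp.sub_snd]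
        gcongr) (h.strongly_monotone z w)
  have hD0 : 0 ≤ D := (norm_nonneg _).trans (hD zs zs)
  have hT0 : (0 : ℝ) < T := lt_of_lt_of_le (by positivity) hT
  set τ := (l + b) / (2 * T * b) with hτdef
  have hτ0 : 0 < τ := by positivity
  have hτ : τ ≤ 1 / 800 := by
    rw [div_le_iff₀ hb] at hT
    rw [hτdef, div_le_iff₀ (by positivity)]
    linarith
  set o := saddleOracle X Y gx gy with ho
  set s : ℕ → Pt E F × Pt E F := fun n => (fun s => (accelStep P a b l τ θ T s).run o)^[n]
    (proxNext τ C (P C) ((proxProc P b l T C).run o).1 ((proxProc P b l T C).run o).2, C)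
  have key : ∀ n, PotentialLE X Y a b φ zs ((1 - θ) ^ n * (20 * b * D ^ 2)) (s n) := by
    intro n
    induction n with
    | zero =>
      obtain ⟨zp, h1, h2, h3⟩ := proxProc_run h ha.le hb hl.le hXc hYc hK hP hT C
      rw [pow_zero, one_mul]
      exact PotentialLE.init h ha hab hzs hτ0.le hτ h1 h2 h3 (hD _ _) (hD _ _)
    | succ n ih =>
      obtain ⟨zp, h1, h2, h3⟩ := proxProc_run h ha.le hb hl.le hXc hYc hK hP hT
        (accelCenter θ (s n))
      have h4 := ih.step h ha hab hzs hθ hθ2 hτ0.le hτ h1 h2 h3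
      have e : s (n + 1) = (accelStep P a b l τ θ T (s n)).run o :=
        Function.iterate_succ_apply' _ _ _
      rw [e, accelStep, OracleProc.run_bind, pow_succ', mul_assoc]
      exact h4
  have hr := (key N).norm_sub_sq_le h hab hzs ha
  have hr2 := hP.norm_sub_coe_le (s N).1 zs
  have e : (saddleSolver P a b l τ θ T N C).run o =
      P (P (s N).1 - l⁻¹ • o (P (s N).1)) := by
    rw [saddleSolver, OracleProc.run_bind, OracleProc.run_bind, OracleProc.run_loop]
    rfl
  rw [e]
  intro u
  refine (hP.projected_step (V := o) hl h.lip hzs hr2 hD u).trans ?_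
  refine le_of_sq_le_sq (le_trans ?_ hN) hε
  have h5 : ‖(s N).1 - zs‖ ^ 2 ≤ 2 / a * ((1 - θ) ^ N * (20 * b * D ^ 2)) := by
    rw [div_mul_eq_mul_div, le_div_iff₀ ha]
    linarith
  calc (6 * l * ‖(s N).1 - zs‖ * D) ^ 2 = 36 * l ^ 2 * D ^ 2 * ‖(s N).1 - zs‖ ^ 2 := by ring
    _ ≤ 36 * l ^ 2 * D ^ 2 * (2 / a * ((1 - θ) ^ N * (20 * b * D ^ 2))) := by gcongr
    _ = (1 - θ) ^ N * (1440 * l ^ 2 * b * D ^ 4 / a) := by field_simp; ring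

/-- The logarithmic factor in the complexity of the saddle point solver. -/
noncomputable def solverLog (a b l D ε : ℝ) : ℝ :=
  Real.log (1 + 1440 * l ^ 3 * D ^ 4 / (min a b * ε ^ 2))

/-- A procedure which solves all saddle point problems with given moduli. -/
def IsSolver (X : Set E) (Y : Set F) (a b l D ε : ℝ)
    (p : OracleProc (feasible X Y) (Pt E F) (feasible X Y)) : Prop :=
  ∀ (φ : E → F → ℝ) (gx : E → F → E) (gy : E → F → F), IsSaddle X Y a b l φ gx gy →
    IsApproxSolution (saddleOracle X Y gx gy) ε (p.run (saddleOracle X Y gx gy)) ∧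
    (p.cost (saddleOracle X Y gx gy) : ℝ) ≤
      3000 * (l / √(a * b)) * (solverLog a b l D ε + 2)

theorem exists_solver_of_le (hX : IsCompact X) (hXc : Convex ℝ X) (hY : IsCompact Y)
    (hYc : Convex ℝ Y) {D ε : ℝ} (ha : 0 < a) (hab : a ≤ b) (hbl : b ≤ l) (hε : 0 < ε)
    (hD : ∀ u w : feasible X Y, ‖(u : Pt E F) - w‖ ≤ D) (C : feasible X Y) :
    ∃ p, IsSolver X Y a b l D ε p := by
  have hb : 0 < b := ha.trans_le hab
  have hl : 0 < l := hb.trans_le hbl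
  have hD0 : 0 ≤ D := (norm_nonneg _).trans (hD C C)
  have hK := isCompact_feasible hX hY
  obtain ⟨P, hP⟩ := exists_isProj ⟨_, C.2⟩ hK (convex_feasible hXc hYc)
  set θ := √(a / (2 * b)) with hθ
  have hθ0 : 0 < θ := by positivity
  have hθ2 : θ ^ 2 = a / (2 * b) := Real.sq_sqrt (by positivity)
  have hθ1 : θ ≤ 1 := by
    rw [hθ, Real.sqrt_le_one, div_le_one (by positivity)]; linarith
  set Λ := solverLog a b l D ε with hΛ
  set x := 1440 * l ^ 3 * D ^ 4 / (min a b * ε ^ 2) with hx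
  have hx0 : 0 ≤ x := by positivity
  have hΛ0 : 0 ≤ Λ := Real.log_nonneg (by linarith)
  set T := ⌈400 * (l + b) / b⌉₊
  set N := ⌈θ⁻¹ * Λ⌉₊
  have hT : 400 * (l + b) / b ≤ T := Nat.le_ceil _
  have hN : θ⁻¹ * Λ ≤ N := Nat.le_ceil _
  refine ⟨saddleSolver P a b l ((l + b) / (2 * T * b)) θ T N C, fun φ gx gy h => ⟨?_, ?_⟩⟩
  · refine saddleSolver_run h ha hab hl hXc hYc hK hP hT hθ0.le hθ2 hD hε.le ?_ C
    have h1 : (1 - θ) ^ N ≤ (1 + x)⁻¹ := by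
      calc (1 - θ) ^ N ≤ Real.exp (-θ) ^ N :=
            pow_le_pow_left₀ (by linarith) (Real.one_sub_le_exp_neg θ) _
        _ = Real.exp (-(N * θ)) := by rw [← Real.exp_nat_mul]; ring_nf
        _ ≤ Real.exp (-Λ) := by
            rw [Real.exp_le_exp, neg_le_neg_iff]
            rwa [inv_mul_le_iff₀ hθ0, mul_comm] at hN
        _ = (1 + x)⁻¹ := by
            rw [Real.exp_neg, hΛ, solverLog, Real.exp_log (by positivity)]
    -- Replacing `b` by `l` makes the logarithm symmetric in `a` and `b`, so that it survives the
    -- exchange of players.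
    have h2 : 1440 * l ^ 2 * b * D ^ 4 / a ≤ x * ε ^ 2 := by
      rw [hx, min_eq_left hab]
      have : 1440 * l ^ 3 * D ^ 4 / (a * ε ^ 2) * ε ^ 2 = 1440 * l ^ 2 * l * D ^ 4 / a := by
        field_simp
      rw [this]
      gcongr
    calc (1 - θ) ^ N * (1440 * l ^ 2 * b * D ^ 4 / a) ≤ (1 + x)⁻¹ * (x * ε ^ 2) := by gcongr
      _ ≤ 1 * ε ^ 2 := by
          rw [← mul_assoc]
          gcongr
          rw [inv_mul_le_iff₀ (by positivity)]
          linarith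
      _ = ε ^ 2 := one_mul _
  · have h1 := cost_saddleSolver_le P a b l ((l + b) / (2 * T * b)) θ T N C
      (saddleOracle X Y gx gy)
    have h2 : (((saddleSolver P a b l ((l + b) / (2 * T * b)) θ T N C).cost (saddleOracle X Y gx gy) : ℕ) : ℝ) ≤ 2 * T * (N + 1) + 1 := by exact_mod_cast h1
    refine h2.trans ?_
    have hlb : 1 ≤ l / b := by rwa [le_div_iff₀ hb, one_mul]
    have hT2 : (T : ℝ) ≤ 801 * (l / b) := by
      have := (Nat.ceil_lt_add_one (by positivity : 0 ≤ 400 * (l + b) / b)).le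
      have e : 400 * (l + b) / b = 400 * (l / b) + 400 := by field_simp
      change (T : ℝ) ≤ _ at this
      linarith
    have hθi : 1 ≤ θ⁻¹ := (one_le_inv₀ hθ0).2 hθ1
    have hN2 : (N : ℝ) + 1 ≤ θ⁻¹ * (Λ + 2) := by
      have := (Nat.ceil_lt_add_one (by positivity : 0 ≤ θ⁻¹ * Λ)).le
      linarith
    have e : l / √(a * b) = (l / b) * √(b / a) := by
      rw [Real.sqrt_div hb.le, Real.sqrt_mul ha.le]
      have := Real.mul_self_sqrt hb.le
      field_simp
      linarith
    have hθ3 : θ⁻¹ = √2 * √(b / a) := by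
      rw [hθ, ← Real.sqrt_inv, ← Real.sqrt_mul (by norm_num)]
      congr 1
      field_simp
    have h22 : √2 ≤ 3 / 2 := by
      rw [Real.sqrt_le_left (by norm_num)]; norm_num
    have hba : 1 ≤ √(b / a) := by
      rw [Real.one_le_sqrt, le_div_iff₀ ha, one_mul]; exact hab
    rw [e]
    have hp : 1 ≤ (l / b) * √(b / a) := by nlinarith
    -- `2403 = 2 · 801 · 3/2`; the rest of 3000 covers the final query.
    calc 2 * (T : ℝ) * (N + 1) + 1
        ≤ 2 * (801 * (l / b)) * (3 / 2 * √(b / a) * (Λ + 2)) + 1 := by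
          gcongr
          refine hN2.trans ?_
          rw [hθ3]
          gcongr
      _ = 2403 * ((l / b) * √(b / a)) * (Λ + 2) + 1 := by ring
      _ ≤ 3000 * (l / b * √(b / a)) * (Λ + 2) := by nlinarith

/-- Exchange the two players. -/
abbrev swapPt {E F : Type*} (z : Pt E F) : Pt F E := pair z.snd z.fst

theorem IsSaddle.swap (h : IsSaddle X Y a b l φ gx gy) :
    IsSaddle Y X b a l (fun y x => -φ x y) (fun y x => -gy x y) (fun y x => -gx x y) where
  convex y hy y' hy' x hx := by
    have := h.concave x hx y hy y' hy'
    simp only [inner_neg_left]; linarith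
  concave y hy x hx x' hx' := by
    have := h.convex x hx x' hx' y hy
    simp only [inner_neg_left]; linarith
  lip z w := by
    have h1 := h.lip ⟨swapPt z, z.2.2, z.2.1⟩ ⟨swapPt w, w.2.2, w.2.1⟩
    refine le_trans (le_of_eq ?_) (h1.trans (le_of_eq ?_))
    · refine (sq_eq_sq₀ (norm_nonneg _) (norm_nonneg _)).1 ?_
      rw [norm_sq_pt, norm_sq_pt (_ - _), add_comm]
      simp [saddleOp]
    · congr 1
      refine (sq_eq_sq₀ (norm_nonneg _) (norm_nonneg _)).1 ?_
      rw [norm_sq_pt, norm_sq_pt (_ - _), add_comm]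
      simp

theorem norm_swapPt_sub (z w : Pt E F) : ‖swapPt z - swapPt w‖ = ‖z - w‖ := by
  refine (sq_eq_sq₀ (norm_nonneg _) (norm_nonneg _)).1 ?_
  rw [norm_sq_pt, norm_sq_pt (z - w), add_comm]
  simp

/-- When `b ≤ a`, the solver is run on `-φ` with the players exchanged; queries and answers are
translated one for one, so the cost is unchanged. -/
theorem exists_solver (hX : IsCompact X) (hXc : Convex ℝ X) (hY : IsCompact Y)
    (hYc : Convex ℝ Y) {D ε : ℝ} (ha : 0 < a) (hb : 0 < b) (hal : a ≤ l) (hbl : b ≤ l)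
    (hε : 0 < ε) (hD : ∀ u w : feasible X Y, ‖(u : Pt E F) - w‖ ≤ D) (C : feasible X Y) :
    ∃ p, IsSolver X Y a b l D ε p := by
  rcases le_total a b with hab | hba
  · exact exists_solver_of_le hX hXc hY hYc ha hab hbl hε hD C
  let f : feasible Y X → feasible X Y := fun z => ⟨swapPt z, z.2.2, z.2.1⟩
  obtain ⟨p, hp⟩ := exists_solver_of_le (D := D) (ε := ε) hY hYc hX hXc hb hba hal hε
    (fun u w => by rw [← norm_swapPt_sub]; exact hD (f u) (f w)) ⟨swapPt C, C.2.2, C.2.1⟩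
  refine ⟨(p.mapOracle f fun _ v => swapPt v).bind fun z => .output (f z), fun φ gx gy h => ?_⟩
  obtain ⟨h1, h2⟩ := hp _ _ _ h.swap
  have e : (fun q : feasible Y X => swapPt (saddleOp gx gy (f q : Pt E F))) =
      saddleOracle Y X (fun y x => -gy x y) (fun y x => -gx x y) := by
    funext z
    simp [saddleOp, f]
  constructor
  · intro u
    have h3 := h1 ⟨swapPt u, u.2.2, u.2.1⟩
    rw [OracleProc.run_bind, OracleProc.run_mapOracle, e]
    refine le_trans (le_of_eq ?_) h3
    simp only [OracleProc.run, inner_pt, saddleOp, WithLp.sub_fst, WithLp.sub_snd, pair_fst,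
      pair_snd, f, neg_neg]
    ring
  · rw [OracleProc.cost_bind, OracleProc.cost_mapOracle, e]
    simp only [OracleProc.cost, add_zero]
    rw [solverLog, min_comm, mul_comm a b]
    exact h2

end Solver

/-! ### First-order inequalities for relative gradients on convex sets -/

section Calculus

variable {H : Type*} [NormedAddCommGroup H] [InnerProductSpace ℝ H]

theorem hasDerivWithinAt_comp_segment {f : H → ℝ} {f' : H →L[ℝ] ℝ} {K : Set H} {z w : H} {t : ℝ}
    (hf : HasFDerivWithinAt f f' K (z + t • (w - z)))
    (hseg : ∀ t ∈ Set.Icc (0 : ℝ) 1, z + t • (w - z) ∈ K) :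
    HasDerivWithinAt (fun t : ℝ => f (z + t • (w - z))) (f' (w - z)) (Set.Icc 0 1) t := by
  have h1 : HasDerivWithinAt (fun t : ℝ => z + t • (w - z)) ((1 : ℝ) • (w - z)) (Set.Icc 0 1) t :=
    (((hasDerivAt_id t).smul_const (w - z)).const_add z).hasDerivWithinAt
  rw [one_smul] at h1
  exact hf.comp_hasDerivWithinAt t h1 hseg

/-- The first order condition for functions that are strongly convex along a segment. -/
theorem first_order_of_convex_segment {f : H → ℝ} {f' : H →L[ℝ] ℝ} {K : Set H} {z w : H} {c : ℝ}
    (hf : HasFDerivWithinAt f f' K z) (hseg : ∀ t ∈ Set.Icc (0 : ℝ) 1, z + t • (w - z) ∈ K)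
    (hconv : ∀ t ∈ Set.Icc (0 : ℝ) 1,
      f (z + t • (w - z)) ≤ (1 - t) * f z + t * f w - c * (t * (1 - t))) :
    f z + f' (w - z) + c ≤ f w := by
  have hf0 : HasFDerivWithinAt f f' K (z + (0 : ℝ) • (w - z)) := by simpa using hf
  -- The convexity inequality is divided by `t` and `t` tends to `0` from the right.
  have h1 := hasDerivWithinAt_iff_tendsto_slope.1 (hasDerivWithinAt_comp_segment hf0 hseg)
  rw [Set.Icc_sdiff_left, nhdsWithin_Ioc_eq_nhdsGT zero_lt_one] at h1
  have h2 : Filter.Tendsto (fun t : ℝ => f w - f z - c * (1 - t)) (nhdsWithin 0 (Set.Ioi 0))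
      (nhds (f w - f z - c * (1 - 0))) :=
    (Continuous.tendsto (by fun_prop) 0).mono_left nhdsWithin_le_nhds
  have h3 := le_of_tendsto_of_tendsto h1 h2 (by
    filter_upwards [Ioc_mem_nhdsGT (zero_lt_one' ℝ)] with t ht
    rw [slope_def_field, zero_smul, add_zero, sub_zero, div_le_iff₀ ht.1]
    linarith [hconv t ⟨ht.1.le, ht.2⟩])
  linarith

/-- The descent inequality for a function with Lipschitz gradient. -/
theorem descent_inequality {f : H → ℝ} {f' : H → H} {K : Set H} {δ : ℝ} (hK : Convex ℝ K)
    (hf : ∀ z ∈ K, HasFDerivWithinAt f (innerSL ℝ (f' z)) K z)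
    (hlip : ∀ z ∈ K, ∀ w ∈ K, ‖f' w - f' z‖ ≤ δ * ‖w - z‖) {z w : H} (hz : z ∈ K) (hw : w ∈ K) :
    f w ≤ f z + inner ℝ (f' z) (w - z) + δ / 2 * ‖w - z‖ ^ 2 := by
  have hseg : ∀ t ∈ Set.Icc (0 : ℝ) 1, z + t • (w - z) ∈ K := fun t ht =>
    hK.add_smul_sub_mem hz hw ht
  -- The Lipschitz bound makes the derivative of `k` nonpositive; the claim is `k 1 ≤ k 0`.
  let k : ℝ → ℝ := fun t => f (z + t • (w - z)) - (t * inner ℝ (f' z) (w - z)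
    + δ / 2 * ‖w - z‖ ^ 2 * t ^ 2)
  have hk : ∀ t ∈ Set.Icc (0 : ℝ) 1, HasDerivWithinAt k
      (inner ℝ (f' (z + t • (w - z))) (w - z) - (1 * inner ℝ (f' z) (w - z)
        + δ / 2 * ‖w - z‖ ^ 2 * (2 * t))) (Set.Icc 0 1) t := by
    intro t ht
    have h1 := hasDerivWithinAt_comp_segment (hf _ (hseg t ht)) hseg
    have h2 : HasDerivAt (fun t : ℝ => t * inner ℝ (f' z) (w - z) + δ / 2 * ‖w - z‖ ^ 2 * t ^ 2)
        (1 * inner ℝ (f' z) (w - z) + δ / 2 * ‖w - z‖ ^ 2 * (2 * t)) t := by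
      have h3 := (hasDerivAt_pow 2 t).const_mul (δ / 2 * ‖w - z‖ ^ 2)
      refine ((hasDerivAt_id t).mul_const _).add (h3.congr_deriv ?_)
      simp
    exact h1.sub h2.hasDerivWithinAt
  have hanti : AntitoneOn k (Set.Icc 0 1) := by
    refine antitoneOn_of_hasDerivWithinAt_nonpos (convex_Icc 0 1)
      (fun t ht => (hk t ht).continuousWithinAt)
      (fun t ht => (hk t (interior_subset ht)).mono interior_subset) fun t ht => ?_
    have ht' := interior_subset ht
    have h1 : inner ℝ (f' (z + t • (w - z)) - f' z) (w - z) ≤ δ * (t * ‖w - z‖) * ‖w - z‖ := by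
      refine (real_inner_le_norm _ _).trans (mul_le_mul_of_nonneg_right ?_ (norm_nonneg _))
      refine (hlip _ hz _ (hseg t ht')).trans (le_of_eq ?_)
      rw [add_sub_cancel_left, norm_smul, Real.norm_of_nonneg ht'.1]
    rw [inner_sub_left] at h1
    linarith
  have := hanti (Set.left_mem_Icc.2 zero_le_one) (Set.right_mem_Icc.2 zero_le_one) zero_le_one
  simp only [k] at this
  simp at this
  linarith

end Calculus

theorem pt_ext {E F : Type*} {z w : Pt E F} (h1 : z.fst = w.fst) (h2 : z.snd = w.snd) : z = w :=
  WithLp.ofLp_injective 2 (Prod.ext h1 h2)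

/-! ### The game as a saddle function plus a smooth convex coupling -/

section GameFacts

variable {E F : Type*} [NormedAddCommGroup E] [InnerProductSpace ℝ E] [FiniteDimensional ℝ E]
  [NormedAddCommGroup F] [InnerProductSpace ℝ F] [FiniteDimensional ℝ F]
  {X : Set E} {Y : Set F} {L μ ν δ : ℝ} {Γ : Game E F}

namespace Game.IsNearZeroSum

theorem hasFDeriv_h (h : Γ.IsNearZeroSum X Y L μ ν δ) {z : Pt E F} (hz : z ∈ feasible X Y) :
    HasFDerivWithinAt Γ.h (innerSL ℝ (Γ.gradH z)) (feasible X Y) z := by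
  have h1 := ((h.hasGrad₁ z hz).hasFDerivWithinAt.neg.add
    (h.hasGrad₂ z hz).hasFDerivWithinAt).const_mul (1 / 2 : ℝ)
  refine h1.congr_fderiv ?_
  ext v
  simp [Game.gradH]

theorem hasFDeriv_g (h : Γ.IsNearZeroSum X Y L μ ν δ) {z : Pt E F} (hz : z ∈ feasible X Y) :
    HasFDerivWithinAt Γ.g (innerSL ℝ (Γ.gradG z)) (feasible X Y) z := by
  have h1 := ((h.hasGrad₁ z hz).hasFDerivWithinAt.add
    (h.hasGrad₂ z hz).hasFDerivWithinAt).const_mul (-(1 / 2) : ℝ)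
  refine h1.congr_fderiv ?_
  ext v
  simp [Game.gradG]

theorem first_order_g (h : Γ.IsNearZeroSum X Y L μ ν δ) {z w : Pt E F}
    (hz : z ∈ feasible X Y) (hw : w ∈ feasible X Y) :
    Γ.g z + inner ℝ (Γ.gradG z) (w - z) ≤ Γ.g w := by
  have := first_order_of_convex_segment (c := 0) (h.hasFDeriv_g hz)
    (fun t ht => h.convex_g.1.add_smul_sub_mem hz hw ht) fun t ht => by
      have := h.convex_g.2 hz hw (sub_nonneg.2 ht.2) ht.1 (sub_add_cancel 1 t)
      have e : z + t • (w - z) = (1 - t) • z + t • w := by module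
      rw [e]
      simpa using this
  simpa using this

theorem descent_g (h : Γ.IsNearZeroSum X Y L μ ν δ) {z w : Pt E F}
    (hz : z ∈ feasible X Y) (hw : w ∈ feasible X Y) :
    Γ.g w ≤ Γ.g z + inner ℝ (Γ.gradG z) (w - z) + δ / 2 * ‖w - z‖ ^ 2 :=
  descent_inequality h.convex_g.1 (fun _ hz => h.hasFDeriv_g hz) h.smooth_g hz hw

theorem norm_sq_comb {V : Type*} [NormedAddCommGroup V] [InnerProductSpace ℝ V] (x x' : V) (t : ℝ) :
    ‖x + t • (x' - x)‖ ^ 2 =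
      (1 - t) * ‖x‖ ^ 2 + t * ‖x'‖ ^ 2 - t * (1 - t) * ‖x' - x‖ ^ 2 := by
  simp only [← real_inner_self_eq_norm_sq, inner_add_left, inner_add_right, inner_sub_left,
    inner_sub_right, real_inner_smul_left, real_inner_smul_right, real_inner_comm x x']
  ring

theorem first_order_h_fst (h : Γ.IsNearZeroSum X Y L μ ν δ) {x x' : E} {y : F}
    (hx : x ∈ X) (hx' : x' ∈ X) (hy : y ∈ Y) :
    Γ.h (pair x y) + inner ℝ (Γ.gradH (pair x y)).fst (x' - x) + μ / 2 * ‖x' - x‖ ^ 2 ≤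
      Γ.h (pair x' y) := by
  have hc := h.convex_h y hy
  have e : ∀ t : ℝ, pair x y + t • (pair x' y - pair x y) = pair (x + t • (x' - x)) y := by
    intro t
    refine pt_ext ?_ ?_ <;> simp
  have := first_order_of_convex_segment (w := pair x' y) (c := μ / 2 * ‖x' - x‖ ^ 2)
    (h.hasFDeriv_h (z := pair x y) ⟨hx, hy⟩)
    (fun t ht => by
      rw [e]
      exact ⟨hc.1.add_smul_sub_mem hx hx' ht, hy⟩) fun t ht => by
      have h1 := hc.2 hx hx' (sub_nonneg.2 ht.2) ht.1 (sub_add_cancel 1 t)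
      have e2 : (1 - t) • x + t • x' = x + t • (x' - x) := by module
      rw [e]
      simp only [e2, norm_sq_comb, smul_eq_mul] at h1
      linarith
  simpa [inner_pt] using this

theorem first_order_h_snd (h : Γ.IsNearZeroSum X Y L μ ν δ) {x : E} {y y' : F}
    (hx : x ∈ X) (hy : y ∈ Y) (hy' : y' ∈ Y) :
    Γ.h (pair x y') ≤
      Γ.h (pair x y) + inner ℝ (Γ.gradH (pair x y)).snd (y' - y) - ν / 2 * ‖y' - y‖ ^ 2 := by
  have hc := h.concave_h x hx
  have e : ∀ t : ℝ, pair x y + t • (pair x y' - pair x y) = pair x (y + t • (y' - y)) := by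
    intro t
    refine pt_ext ?_ ?_ <;> simp
  have := first_order_of_convex_segment (w := pair x y') (c := ν / 2 * ‖y' - y‖ ^ 2)
    (h.hasFDeriv_h (z := pair x y) ⟨hx, hy⟩).neg
    (fun t ht => by
      rw [e]
      exact ⟨hx, hc.1.add_smul_sub_mem hy hy' ht⟩) fun t ht => by
      have h1 := hc.2 hy hy' (sub_nonneg.2 ht.2) ht.1 (sub_add_cancel 1 t)
      have e2 : (1 - t) • y + t • y' = y + t • (y' - y) := by module
      rw [e]
      simp only [e2, norm_sq_comb, smul_eq_mul, Pi.neg_apply] at h1 ⊢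
      linarith
  simp at this
  linarith

theorem lip_h (h : Γ.IsNearZeroSum X Y L μ ν δ) {z w : Pt E F}
    (hz : z ∈ feasible X Y) (hw : w ∈ feasible X Y) :
    ‖Γ.gradH z - Γ.gradH w‖ ≤ L * ‖z - w‖ := by
  have h1 := h.smooth₁ w hw z hz
  have h2 := h.smooth₂ w hw z hz
  have e : Γ.gradH z - Γ.gradH w =
      (1 / 2 : ℝ) • ((Γ.grad₂ z - Γ.grad₂ w) - (Γ.grad₁ z - Γ.grad₁ w)) := by
    simp only [Game.gradH]; module
  rw [e, norm_smul, Real.norm_of_nonneg (by norm_num)]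
  linarith [norm_sub_le (Γ.grad₂ z - Γ.grad₂ w) (Γ.grad₁ z - Γ.grad₁ w)]

/-- The zero-sum part is a saddle function. -/
theorem isSaddle_h (h : Γ.IsNearZeroSum X Y L μ ν δ) :
    IsSaddle X Y μ ν L (fun x y => Γ.h (pair x y)) (fun x y => (Γ.gradH (pair x y)).fst)
      (fun x y => (Γ.gradH (pair x y)).snd) where
  convex _ hx _ hx' _ hy := h.first_order_h_fst hx hx' hy
  concave _ hx _ hy _ hy' := h.first_order_h_snd hx hy hy'
  lip z w := by
    refine le_trans (le_of_eq ?_) (h.lip_h z.2 w.2)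
    refine (sq_eq_sq₀ (norm_nonneg _) (norm_nonneg _)).1 ?_
    rw [norm_sq_pt, norm_sq_pt (Γ.gradH _ - _)]
    simp only [saddleOp, WithLp.sub_fst, WithLp.sub_snd, pair_fst, pair_snd, ← neg_sub', norm_neg]
    rfl

/-- The objective of the subproblem is a saddle function. -/
theorem isSaddle_phi (h : Γ.IsNearZeroSum X Y L μ ν δ) {η : ℝ} (hη : 0 < η) (w : Pt E F) :
    IsSaddle X Y (μ + 1 / η) (ν + 1 / η) (L + 1 / η) (fun x y => Γ.phi η w (pair x y))
      (fun x y => (Γ.gradPhi η w (pair x y)).fst) (fun x y => (Γ.gradPhi η w (pair x y)).snd) where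
  convex x hx x' hx' y hy := by
    have h1 := h.first_order_h_fst hx hx' hy
    have e : 1 / (2 * η) = 1 / 2 * (1 / η) := by ring
    simp only [Game.phi, Game.gradPhi, pair_fst, pair_snd, e]
    generalize 1 / η = κ
    simp only [← real_inner_self_eq_norm_sq, inner_add_left, inner_sub_left,
      inner_sub_right, real_inner_smul_left, real_inner_comm w.fst x, real_inner_comm w.fst x',
      real_inner_comm x x'] at *
    linarith
  concave x hx y hy y' hy' := by
    have h1 := h.first_order_h_snd hx hy hy'
    have e : 1 / (2 * η) = 1 / 2 * (1 / η) := by ring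
    simp only [Game.phi, Game.gradPhi, pair_fst, pair_snd, e]
    generalize 1 / η = κ
    simp only [← real_inner_self_eq_norm_sq, inner_sub_left,
      inner_sub_right, real_inner_smul_left, real_inner_comm w.snd y, real_inner_comm w.snd y',
      real_inner_comm y y'] at *
    linarith
  lip z z' := by
    have e : saddleOp (fun x y => (Γ.gradPhi η w (pair x y)).fst)
          (fun x y => (Γ.gradPhi η w (pair x y)).snd) z -
        saddleOp (fun x y => (Γ.gradPhi η w (pair x y)).fst)
          (fun x y => (Γ.gradPhi η w (pair x y)).snd) z' =
        (saddleOp (fun x y => (Γ.gradH (pair x y)).fst) (fun x y => (Γ.gradH (pair x y)).snd) z -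
          saddleOp (fun x y => (Γ.gradH (pair x y)).fst)
            (fun x y => (Γ.gradH (pair x y)).snd) z') + (1 / η) • ((z : Pt E F) - z') := by
      refine pt_ext ?_ ?_
      · simp only [saddleOp, WithLp.sub_fst, WithLp.add_fst, WithLp.smul_fst, pair_fst,
          Game.gradPhi]
        module
      · simp only [saddleOp, WithLp.sub_snd, WithLp.add_snd, WithLp.smul_snd, pair_snd,
          Game.gradPhi]
        module
    rw [e, add_mul]
    refine (norm_add_le _ _).trans (add_le_add (h.isSaddle_h.lip z z') ?_)
    rw [norm_smul, Real.norm_of_nonneg (by positivity)]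

end Game.IsNearZeroSum

end GameFacts

/-! ### Step size, rate and accuracy in terms of `max δ (min μ ν)` -/

section Parameters

variable {μ ν δ ε : ℝ}

theorem inv_stepSize (hμ : 0 < μ) (hν : 0 < ν) (hδ : 0 ≤ δ) :
    (stepSize μ ν δ)⁻¹ = max δ (min μ ν) := by
  have hm : 0 < min μ ν := lt_min hμ hν
  rw [stepSize]
  split_ifs with h
  · rw [h, one_div, inv_inv, max_eq_right hm.le]
  · have hδ' : 0 < δ := lt_of_le_of_ne hδ (Ne.symm h)
    rcases le_total δ (min μ ν) with h1 | h1
    · rw [max_eq_right h1, min_eq_right (one_div_le_one_div_of_le hδ' h1), one_div, inv_inv]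
    · rw [max_eq_left h1, min_eq_left (one_div_le_one_div_of_le hm h1), one_div, inv_inv]

theorem rate_eq (hμ : 0 < μ) (hν : 0 < ν) (hδ : 0 ≤ δ) :
    rate μ ν δ = min μ ν / (max δ (min μ ν) + min μ ν) := by
  rw [rate, inv_stepSize hμ hν hδ]

theorem innerAccuracy_eq (hμ : 0 < μ) (hν : 0 < ν) (hδ : 0 ≤ δ) :
    innerAccuracy μ ν δ ε = rate μ ν δ * ε * max δ (min μ ν) / 4 := by
  rw [innerAccuracy, ← inv_stepSize hμ hν hδ]
  ring

end Parameters

/-! ### Existence of the equilibrium and convergence of the outer loop -/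

section Convergence

variable {E F : Type*} [NormedAddCommGroup E] [InnerProductSpace ℝ E] [FiniteDimensional ℝ E]
  [NormedAddCommGroup F] [InnerProductSpace ℝ F] [FiniteDimensional ℝ F]
  {X : Set E} {Y : Set F} {L μ ν δ ε : ℝ} {Γ : Game E F}

namespace Game

/-- The operator `(∂ₓh, -∂_yh)` of the zero-sum part. -/
noncomputable def opH (Γ : Game E F) (z : Pt E F) : Pt E F :=
  pair (Γ.gradH z).fst (-(Γ.gradH z).snd)

namespace IsNearZeroSum

theorem opH_lip (h : Γ.IsNearZeroSum X Y L μ ν δ) (z w : feasible X Y) :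
    ‖Γ.opH z - Γ.opH w‖ ≤ L * ‖(z : Pt E F) - w‖ :=
  h.isSaddle_h.lip z w

theorem opH_mono (h : Γ.IsNearZeroSum X Y L μ ν δ) (z w : feasible X Y) :
    min μ ν * ‖(z : Pt E F) - w‖ ^ 2 ≤ inner ℝ (Γ.opH z - Γ.opH w) ((z : Pt E F) - w) := by
  refine le_trans ?_ (h.isSaddle_h.strongly_monotone z w)
  rw [norm_sq_pt, mul_add]
  exact add_le_add (mul_le_mul_of_nonneg_right (min_le_left _ _) (sq_nonneg _))
    (mul_le_mul_of_nonneg_right (min_le_right _ _) (sq_nonneg _))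

/-- Strongly monotone games have a Nash equilibrium, which solves the variational inequality. -/
theorem exists_isNash (h : Γ.IsNearZeroSum X Y L μ ν δ) (hμ : 0 < μ) (hν : 0 < ν)
    (hX : IsCompact X) (hXc : Convex ℝ X) (hY : IsCompact Y) (hYc : Convex ℝ Y)
    (hne : (feasible X Y).Nonempty) :
    ∃ zs : feasible X Y, Γ.IsNash X Y zs ∧
      ∀ u : feasible X Y, 0 ≤ inner ℝ (Γ.gradG zs + Γ.opH zs) ((u : Pt E F) - zs) := by
  have hK := isCompact_feasible hX hY
  obtain ⟨P, hP⟩ := exists_isProj hne hK (convex_feasible hXc hYc)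
  have hm : 0 < min μ ν := lt_min hμ hν
  -- This operator is `(-∇ₓu₁, -∇_y u₂)`. Convexity of `g` makes `∇g` monotone, so the modulus of
  -- `opH` is preserved.
  obtain ⟨zs, hzs⟩ := hP.exists_solution hne hK (V := fun z => Γ.gradG z + Γ.opH z) (l := δ + L) hm
    (fun z w => by
      rw [add_sub_add_comm, add_mul]
      exact (norm_add_le _ _).trans (add_le_add (h.smooth_g _ w.2 _ z.2) (h.opH_lip z w)))
    (fun z w => by
      rw [add_sub_add_comm, inner_add_left]
      have h1 := h.opH_mono z w
      have h2 := h.first_order_g z.2 w.2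
      have h3 := h.first_order_g w.2 z.2
      rw [← neg_sub, inner_neg_right] at h2
      rw [inner_sub_left (Γ.gradG z)]
      linarith)
  refine ⟨zs, ⟨zs.2, fun x hx => ?_, fun y hy => ?_⟩, hzs⟩
  · obtain ⟨zs, hz⟩ := zs
    have h1 := hzs ⟨pair x zs.snd, hx, hz.2⟩
    have h2 := h.first_order_g (w := pair x zs.snd) hz ⟨hx, hz.2⟩
    have h3 := h.first_order_h_fst hz.1 hx hz.2
    have h4 : 0 ≤ μ / 2 * ‖x - zs.fst‖ ^ 2 := by positivity
    simp only [inner_pt, opH, WithLp.sub_fst, WithLp.sub_snd,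
      pair_fst, pair_snd, sub_self, inner_zero_right, add_zero, inner_add_left] at h1 h2
    change Γ.g zs + _ ≤ _ at h2
    change Γ.h zs + inner ℝ (Γ.gradH zs).fst _ + _ ≤ _ at h3
    change Γ.u₁ (pair x zs.snd) ≤ Γ.u₁ zs
    simp only [Game.g, Game.h] at h2 h3
    linarith
  · obtain ⟨zs, hz⟩ := zs
    have h1 := hzs ⟨pair zs.fst y, hz.1, hy⟩
    have h2 := h.first_order_g (w := pair zs.fst y) hz ⟨hz.1, hy⟩
    have h3 := h.first_order_h_snd hz.1 hz.2 hy
    have h4 : 0 ≤ ν / 2 * ‖y - zs.snd‖ ^ 2 := by positivity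
    simp only [inner_pt, opH, WithLp.sub_fst, WithLp.sub_snd,
      pair_fst, pair_snd, sub_self, inner_zero_right, zero_add, inner_add_left,
      inner_neg_left] at h1 h2
    change Γ.g zs + _ ≤ _ at h2
    change _ ≤ Γ.h zs + inner ℝ (Γ.gradH zs).snd _ - _ at h3
    change Γ.u₂ (pair zs.fst y) ≤ Γ.u₂ zs
    simp only [Game.g, Game.h] at h2 h3
    linarith

theorem inner_gradPhi (Γ : Game E F) (η : ℝ) (w z u : Pt E F) :
    inner ℝ (Γ.gradPhi η w z).fst (z.fst - u.fst) - inner ℝ (Γ.gradPhi η w z).snd (z.snd - u.snd) =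
      inner ℝ (Γ.gradG w + (1 / η) • (z - w) + Γ.opH z) (z - u) := by
  simp only [inner_pt, gradPhi, opH, WithLp.sub_fst,
    WithLp.sub_snd, pair_fst, pair_snd, inner_add_left,
    inner_sub_left, inner_neg_left, real_inner_smul_left]
  ring

/-- One outer iteration. -/
theorem outer_step (h : Γ.IsNearZeroSum X Y L μ ν δ) (hμ : 0 < μ) (hν : 0 < ν) (hε : 0 < ε)
    {zs w z : feasible X Y}
    (hzs : ∀ u : feasible X Y, 0 ≤ inner ℝ (Γ.gradG zs + Γ.opH zs) ((u : Pt E F) - zs))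
    (hz : Γ.IsInexactSolution X Y (stepSize μ ν δ) (innerAccuracy μ ν δ ε) w z) :
    ‖(z : Pt E F) - zs‖ ^ 2 - ε / 2 ≤
      (1 - rate μ ν δ) * (‖(w : Pt E F) - zs‖ ^ 2 - ε / 2) := by
  have hm : 0 < min μ ν := lt_min hμ hν
  have hδ := h.delta_mem.1
  have h1 := hz _ zs.2.1 _ zs.2.2
  rw [inner_gradPhi, one_div, inv_stepSize hμ hν hδ, innerAccuracy_eq hμ hν hδ,
    rate_eq hμ hν hδ] at h1
  rw [rate_eq hμ hν hδ]
  have hδκ : δ ≤ max δ (min μ ν) := le_max_left _ _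
  have hmκ : min μ ν ≤ max δ (min μ ν) := le_max_right _ _
  have h2 := h.opH_mono z zs
  set m := min μ ν
  set κ := max δ m
  have hκ : 0 < κ := hm.trans_le hmκ
  -- Descent from `w` to `z`, convexity from `w` to `zs` and from `zs` to `z` give `⟨∇g(w), z - zs⟩
  -- ≥ ⟨∇g(zs), z - zs⟩ - (κ/2)‖z - w‖²`. The last term cancels against the one in the three-point
  -- identity `e`.
  have h3 := hzs z
  have h4 := h.descent_g w.2 z.2
  have h5 := h.first_order_g w.2 zs.2
  have h6 := h.first_order_g zs.2 z.2
  have h7 : δ / 2 * ‖(z : Pt E F) - w‖ ^ 2 ≤ κ / 2 * ‖(z : Pt E F) - w‖ ^ 2 := by gcongr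
  have e : 2 * inner ℝ ((z : Pt E F) - w) ((z : Pt E F) - zs) =
      ‖(z : Pt E F) - w‖ ^ 2 + ‖(z : Pt E F) - zs‖ ^ 2 - ‖(w : Pt E F) - zs‖ ^ 2 := by
    simp only [← real_inner_self_eq_norm_sq, inner_sub_left, inner_sub_right]
    rw [real_inner_comm (w : Pt E F) z, real_inner_comm (zs : Pt E F) z,
      real_inner_comm (zs : Pt E F) w]
    ring
  have h8 : (κ / 2 + m) * ‖(z : Pt E F) - zs‖ ^ 2 ≤
      κ / 2 * ‖(w : Pt E F) - zs‖ ^ 2 + m / (κ + m) * ε * κ / 4 := by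
    have e2 : inner ℝ (Γ.gradG w) ((z : Pt E F) - zs) =
        inner ℝ (Γ.gradG w) ((z : Pt E F) - w) - inner ℝ (Γ.gradG w) ((zs : Pt E F) - w) := by
      rw [← inner_sub_right]; congr 1; abel
    rw [inner_add_left, inner_add_left, real_inner_smul_left] at h1
    rw [inner_add_left] at h3
    rw [inner_sub_left] at h2
    nlinarith
  set V := ‖(z : Pt E F) - zs‖ ^ 2
  set W := ‖(w : Pt E F) - zs‖ ^ 2
  have hW : 0 ≤ W := sq_nonneg _
  have e3 : (1 - m / (κ + m)) * (W - ε / 2) = κ * (W - ε / 2) / (κ + m) := by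
    field_simp; ring
  have e4 : m / (κ + m) * ε * κ / 4 = m * ε * κ / 4 / (κ + m) := by ring
  rw [e3, le_div_iff₀ (by positivity)]
  rw [e4, ← sub_le_iff_le_add', le_div_iff₀ (by positivity)] at h8
  -- `h8` contracts by `κ/(κ + 2m)`, better than the required `κ/(κ + m)`; the inexactness fits
  -- below the threshold `ε/2`.
  by_contra! hcon
  have h9 : κ * W + m * ε / 2 < V * (κ + m) := by nlinarith
  have h10 : 0 ≤ m * κ * W := by positivity
  have h11 := mul_lt_mul_of_pos_left h9 (by positivity : 0 < κ / 2 + m)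
  nlinarith [mul_pos (mul_pos hm hm) hε, mul_pos (mul_pos hm hκ) hε]

/-- Any run of the algorithm is accurate after sufficiently many iterations. -/
theorem run_accurate (h : Γ.IsNearZeroSum X Y L μ ν δ) (hμ : 0 < μ) (hν : 0 < ν) (hε : 0 < ε)
    (hX : IsCompact X) (hXc : Convex ℝ X) (hY : IsCompact Y) (hYc : Convex ℝ Y) {D : ℝ}
    (hD : ∀ u w : feasible X Y, ‖(u : Pt E F) - w‖ ≤ D) {T : ℕ} {z : ℕ → Pt E F}
    (hz : Γ.IsICLRun X Y (stepSize μ ν δ) (innerAccuracy μ ν δ ε) T z)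
    (hT : 1 / rate μ ν δ * Real.log (2 * D ^ 2 / ε) ≤ T) : Γ.IsAccurateNash X Y ε (z T) := by
  obtain ⟨hmem, hsol⟩ := hz
  obtain ⟨zs, hnash, hzs⟩ := h.exists_isNash hμ hν hX hXc hY hYc ⟨_, hmem 0 (Nat.zero_le _)⟩
  refine ⟨hmem T le_rfl, zs, hnash, ?_⟩
  have hm : 0 < min μ ν := lt_min hμ hν
  have hθ : 0 < rate μ ν δ ∧ rate μ ν δ ≤ 1 := by
    rw [rate_eq hμ hν h.delta_mem.1]
    have : 0 ≤ max δ (min μ ν) := hm.le.trans (le_max_right _ _)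
    exact ⟨by positivity, by rw [div_le_one (by positivity)]; linarith⟩
  set θ := rate μ ν δ
  have key : ∀ t ≤ T, ‖z t - zs‖ ^ 2 - ε / 2 ≤ (1 - θ) ^ t * D ^ 2 := by
    intro t
    induction t with
    | zero =>
      intro _
      have := pow_le_pow_left₀ (norm_nonneg _) (hD ⟨z 0, hmem 0 (Nat.zero_le _)⟩ zs) 2
      change ‖z 0 - zs‖ ^ 2 ≤ _ at this
      simp only [pow_zero, one_mul]
      linarith
    | succ t ih =>
      intro ht
      have h1 := h.outer_step hμ hν hε (w := ⟨z t, hmem t (by omega)⟩)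
        (z := ⟨z (t + 1), hmem _ ht⟩) hzs (hsol t (by omega))
      refine h1.trans ?_
      rw [pow_succ' (1 - θ), mul_assoc]
      exact mul_le_mul_of_nonneg_left (ih (by omega)) (by linarith [hθ.2])
  have h1 := key T le_rfl
  have h2 : (1 - θ) ^ T * D ^ 2 ≤ ε / 2 := by
    -- For `D = 0` the logarithm in `hT` is `log 0 = 0` and carries no information, but the claim is
    -- then trivial.
    rcases eq_or_ne D 0 with rfl | hD0
    · rw [zero_pow two_ne_zero, mul_zero]; positivity
    · have hD2 : 0 < D ^ 2 := by positivity
      have h3 : (1 - θ) ^ T ≤ ε / (2 * D ^ 2) := by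
        calc (1 - θ) ^ T ≤ Real.exp (-θ) ^ T :=
              pow_le_pow_left₀ (by linarith [hθ.2]) (Real.one_sub_le_exp_neg θ) _
          _ = Real.exp (-(T * θ)) := by rw [← Real.exp_nat_mul]; ring_nf
          _ ≤ Real.exp (-Real.log (2 * D ^ 2 / ε)) := by
              rw [Real.exp_le_exp, neg_le_neg_iff]
              rwa [one_div, inv_mul_le_iff₀ hθ.1, mul_comm θ] at hT
          _ = ε / (2 * D ^ 2) := by
              rw [Real.exp_neg, Real.exp_log (by positivity), inv_div]
      calc (1 - θ) ^ T * D ^ 2 ≤ ε / (2 * D ^ 2) * D ^ 2 := by gcongr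
        _ = ε / 2 := by field_simp
  have h3 := norm_sq_pt (z T - (zs : Pt E F))
  rw [WithLp.sub_fst, WithLp.sub_snd] at h3
  rw [← h3]
  linarith

end IsNearZeroSum

end Game

end Convergence

/-! ### Arithmetic of the query bound -/

section Complexity

variable {μ ν δ ε L D : ℝ}

/-- The smoothness and strong convexity of the subproblem, against the parameters of the game. -/
theorem condition_number_le (hμ : 0 < μ) (hν : 0 < ν) (hL : 0 < L) :
    max δ (min μ ν) / min μ ν *
        (L / √((μ + max δ (min μ ν)) * (ν + max δ (min μ ν)))) ≤
      L / √(μ * ν) + L / min μ ν * min 1 (√(δ / (μ + ν))) := by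
  have hm : 0 < min μ ν := lt_min hμ hν
  have h1 : 0 ≤ L / √(μ * ν) := by positivity
  have h2 : 0 ≤ L / min μ ν * min 1 (√(δ / (μ + ν))) := by positivity
  rcases le_total δ (min μ ν) with h | h
  · rw [max_eq_right h, div_self hm.ne', one_mul]
    refine le_trans ?_ (le_add_of_nonneg_right h2)
    gcongr
    · linarith
    · linarith
  · rw [max_eq_left h]
    have hδ : 0 < δ := hm.trans_le h
    refine le_trans ?_ (le_add_of_nonneg_left h1)
    have e : δ / min μ ν * (L / √((μ + δ) * (ν + δ))) =
        L / min μ ν * (δ / √((μ + δ) * (ν + δ))) := by ring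
    rw [e]
    -- For `κ = δ` both bounds come from expanding `(μ + δ)(ν + δ)`, which is at least `δ²` and at
    -- least `δ(μ + ν)`.
    refine mul_le_mul_of_nonneg_left (le_min ?_ ?_) (by positivity)
    · rw [div_le_one (by positivity)]
      refine Real.le_sqrt_of_sq_le ?_
      nlinarith [mul_pos hμ hν, mul_pos hμ hδ, mul_pos hν hδ]
    · refine Real.le_sqrt_of_sq_le ?_
      rw [div_pow, Real.sq_sqrt (by positivity), div_le_div_iff₀ (by positivity) (by positivity)]
      nlinarith [mul_pos (mul_pos hμ hν) hδ, mul_pos hδ (mul_pos hδ hδ)]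

/-- The logarithmic factor of the inner solver. -/
theorem solverLog_le (hμ : 0 < μ) (hν : 0 < ν) (hδ : 0 ≤ δ) (hε : 0 < ε) (hμL : μ ≤ L)
    (hδL : δ ≤ L) (hDε : ε < 2 * D ^ 2) :
    solverLog (μ + max δ (min μ ν)) (ν + max δ (min μ ν)) (L + max δ (min μ ν)) D
        (innerAccuracy μ ν δ ε) + 2 ≤
      26 * max 1 (Real.log (L * D ^ 2 / (min μ ν * ε))) := by
  have hm : 0 < min μ ν := lt_min hμ hν
  have hL : 0 < L := hμ.trans_le hμL
  rw [innerAccuracy_eq hμ hν hδ, rate_eq hμ hν hδ]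
  have hκL : max δ (min μ ν) ≤ L := max_le hδL ((min_le_left _ _).trans hμL)
  have hκm : min μ ν ≤ max δ (min μ ν) := le_max_right _ _
  have hmμ : min μ ν ≤ μ := min_le_left _ _
  have hmν : min μ ν ≤ ν := min_le_right _ _
  set m := min μ ν
  set κ := max δ m
  have hκ : 0 < κ := hm.trans_le hκm
  have hD : 0 < D ^ 2 := by linarith
  set ε' := m / (κ + m) * ε * κ / 4 with hε'
  have h1 : m * ε / 8 ≤ ε' := by
    have e : ε' = m * ε / 4 * (κ / (κ + m)) := by rw [hε']; ring
    have h2 : 1 / 2 ≤ κ / (κ + m) := by rw [div_le_div_iff₀ two_pos (by positivity)]; linarith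
    rw [e]
    have := mul_le_mul_of_nonneg_left h2 (by positivity : 0 ≤ m * ε / 4)
    linarith
  set y := L * D ^ 2 / (m * ε) with hy
  have hy0 : 0 < y := by positivity
  -- As `ε < 2D²`, the condition number `L / m` is itself controlled by `y`, so the logarithm in `y`
  -- alone suffices. Together with `1 ≤ L / m` this gives `y ≥ 1/2`, which absorbs the `1 +` in
  -- `solverLog`.
  have hLm : L / m ≤ 2 * y := by
    have e : 2 * y = L / m * (2 * D ^ 2 / ε) := by rw [hy]; field_simp
    have h2 : 1 ≤ 2 * D ^ 2 / ε := by rw [le_div_iff₀ hε]; linarith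
    rw [e]
    exact le_mul_of_one_le_right (by positivity) h2
  have hLm1 : 1 ≤ L / m := by
    rw [le_div_iff₀ hm, one_mul]; exact hmμ.trans hμL
  have hx : 1440 * (L + κ) ^ 3 * D ^ 4 / (min (μ + κ) (ν + κ) * ε' ^ 2) ≤ 1474560 * y ^ 3 := by
    have h2 : m ≤ min (μ + κ) (ν + κ) := le_min (by linarith) (by linarith)
    calc 1440 * (L + κ) ^ 3 * D ^ 4 / (min (μ + κ) (ν + κ) * ε' ^ 2)
        ≤ 1440 * (2 * L) ^ 3 * D ^ 4 / (m * (m * ε / 8) ^ 2) := by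
          gcongr
          linarith
      _ = 737280 * (L / m * y ^ 2) := by rw [hy]; field_simp; ring
      _ ≤ 737280 * (2 * y * y ^ 2) := by gcongr
      _ = 1474560 * y ^ 3 := by ring
  have hy3 : 1 ≤ 8 * y ^ 3 := by
    have h2 : 1 / 2 ≤ y := by linarith
    have := pow_le_pow_left₀ (by norm_num) h2 3
    linarith
  have h3 : solverLog (μ + κ) (ν + κ) (L + κ) D ε' ≤ Real.log (2 ^ 21 * y ^ 3) := by
    rw [solverLog]
    refine Real.log_le_log (by positivity) ?_
    linarith
  rw [Real.log_mul (by positivity) (by positivity), Real.log_pow, Real.log_pow] at h3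
  have h4 : Real.log 2 ≤ 1 := by linarith [Real.log_two_lt_d9]
  have h5 := le_max_left 1 (Real.log y)
  have h6 := le_max_right 1 (Real.log y)
  push_cast at h3
  linarith

/-- The bound on the number of outer iterations. -/
theorem outer_count_le (hμ : 0 < μ) (hν : 0 < ν) (hδ : 0 ≤ δ) (hε : 0 < ε)
    (hDε : ε < 2 * D ^ 2) :
    (⌈1 / rate μ ν δ * Real.log (2 * D ^ 2 / ε)⌉₊ : ℝ) ≤
      6 * (max δ (min μ ν) / min μ ν) * max 1 (Real.log (D ^ 2 / ε)) := by
  have hm : 0 < min μ ν := lt_min hμ hν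
  have hκm : min μ ν ≤ max δ (min μ ν) := le_max_right _ _
  rw [rate_eq hμ hν hδ, one_div_div]
  set m := min μ ν
  set κ := max δ m
  set A := max 1 (Real.log (D ^ 2 / ε)) with hA
  have hD : 0 < D ^ 2 := by linarith
  have h1 : 0 ≤ Real.log (2 * D ^ 2 / ε) := Real.log_nonneg (by rw [le_div_iff₀ hε]; linarith)
  have h2 : Real.log (2 * D ^ 2 / ε) ≤ 2 * A := by
    rw [mul_div_assoc, Real.log_mul two_ne_zero (by positivity)]
    linarith [Real.log_two_lt_d9, le_max_left 1 (Real.log (D ^ 2 / ε)),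
      le_max_right 1 (Real.log (D ^ 2 / ε))]
  have hκ : 1 ≤ κ / m := by rwa [le_div_iff₀ hm, one_mul]
  have h3 : (κ + m) / m ≤ 2 * (κ / m) := by
    rw [add_div, div_self hm.ne']; linarith
  have hA1 : 1 ≤ A := le_max_left _ _
  have h4 : (κ + m) / m * Real.log (2 * D ^ 2 / ε) ≤ 2 * (κ / m) * (2 * A) := by
    gcongr
  -- Rounding up adds at most 1, and `(κ / m) A ≥ 1`, so the factor 4 becomes at most 6.
  have h5 := (Nat.ceil_lt_add_one
    (mul_nonneg (zero_le_one.trans (by rw [add_div, div_self hm.ne']; linarith)) h1 :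
      0 ≤ (κ + m) / m * Real.log (2 * D ^ 2 / ε))).le
  nlinarith [mul_le_mul hκ hA1 zero_le_one (zero_le_one.trans hκ)]

end Complexity

/-! ### The inner-loop method in the oracle model -/

section Method

variable {E F : Type*} [NormedAddCommGroup E] [InnerProductSpace ℝ E] [FiniteDimensional ℝ E]
  [NormedAddCommGroup F] [InnerProductSpace ℝ F] [FiniteDimensional ℝ F]
  {X : Set E} {Y : Set F} {L μ ν δ ε D : ℝ}

/-- The operator of the subproblem at `w`, computed from the answers `r` and `s` of the oracle at
`w` and at `z`. -/
noncomputable def answerOp (η : ℝ) (w z : Pt E F) (r s : Pt E F × Pt E F) : Pt E F :=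
  let gw : Pt E F := (-(1 / 2) : ℝ) • (r.1 + r.2)
  let hz : Pt E F := (1 / 2 : ℝ) • (-s.1 + s.2)
  pair (gw.fst + (1 / η) • (z.fst - w.fst) + hz.fst)
    (-(hz.snd - gw.snd - (1 / η) • (z.snd - w.snd)))

/-- The inner-loop method which queries the current iterate and then runs a solver for the
subproblem. -/
noncomputable def innerMethod (η : ℝ)
    (p : feasible X Y → OracleProc (feasible X Y) (Pt E F) (feasible X Y)) : InnerMethod X Y :=
  fun w => .query w fun r => (p w).mapOracle id fun z s => answerOp η w z r s

theorem run_innerMethod (η : ℝ)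
    (p : feasible X Y → OracleProc (feasible X Y) (Pt E F) (feasible X Y)) (Γ : Game E F)
    (w : feasible X Y) :
    (innerMethod η p w).run (Γ.oracle X Y) = (p w).run
      (saddleOracle X Y (fun x y => (Γ.gradPhi η w (pair x y)).fst)
        (fun x y => (Γ.gradPhi η w (pair x y)).snd)) :=
  OracleProc.run_mapOracle _ _ _ _

theorem cost_innerMethod (η : ℝ)
    (p : feasible X Y → OracleProc (feasible X Y) (Pt E F) (feasible X Y)) (Γ : Game E F)
    (w : feasible X Y) :
    (innerMethod η p w).cost (Γ.oracle X Y) = (p w).cost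
      (saddleOracle X Y (fun x y => (Γ.gradPhi η w (pair x y)).fst)
        (fun x y => (Γ.gradPhi η w (pair x y)).snd)) + 1 :=
  congrArg (· + 1) (OracleProc.cost_mapOracle _ _ _ _)

theorem norm_sub_le_of_diam {DX DY : ℝ} (hDX : ∀ x ∈ X, ∀ x' ∈ X, ‖x - x'‖ ≤ DX)
    (hDY : ∀ y ∈ Y, ∀ y' ∈ Y, ‖y - y'‖ ≤ DY) (u w : feasible X Y) :
    ‖(u : Pt E F) - w‖ ≤ √(DX ^ 2 + DY ^ 2) := by
  refine Real.le_sqrt_of_sq_le ?_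
  rw [norm_sq_pt, WithLp.sub_fst, WithLp.sub_snd]
  exact add_le_add (pow_le_pow_left₀ (norm_nonneg _) (hDX _ u.2.1 _ w.2.1) 2)
    (pow_le_pow_left₀ (norm_nonneg _) (hDY _ u.2.2 _ w.2.2) 2)

/-- There is an inner-loop method with a single logarithmic factor. -/
theorem exists_innerMethod (hX : IsCompact X) (hXc : Convex ℝ X) (hY : IsCompact Y)
    (hYc : Convex ℝ Y) (hμ : 0 < μ) (hν : 0 < ν) (hε : 0 < ε)
    (hD : ∀ u w : feasible X Y, ‖(u : Pt E F) - w‖ ≤ D) :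
    ∃ S : InnerMethod X Y, ∀ Γ : Game E F, Γ.IsNearZeroSum X Y L μ ν δ → ∀ w : feasible X Y,
      Γ.IsInexactSolution X Y (stepSize μ ν δ) (innerAccuracy μ ν δ ε) w
        ((S w).run (Γ.oracle X Y) : feasible X Y) ∧
      ((S w).cost (Γ.oracle X Y) : ℝ) ≤ 3000 * ((L + max δ (min μ ν)) /
          √((μ + max δ (min μ ν)) * (ν + max δ (min μ ν)))) *
        (solverLog (μ + max δ (min μ ν)) (ν + max δ (min μ ν)) (L + max δ (min μ ν)) D
          (innerAccuracy μ ν δ ε) + 2) + 1 := by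
  by_cases hpar : 0 ≤ δ ∧ μ ≤ L ∧ ν ≤ L
  swap
  · exact ⟨fun w => .output w, fun Γ h =>
      absurd ⟨h.delta_mem.1, h.mu_mem.2, h.nu_mem.2⟩ hpar⟩
  obtain ⟨hδ, hμL, hνL⟩ := hpar
  have hm : 0 < min μ ν := lt_min hμ hν
  have hκ : 0 < max δ (min μ ν) := hm.trans_le (le_max_right _ _)
  have hacc : 0 < innerAccuracy μ ν δ ε := by
    rw [innerAccuracy_eq hμ hν hδ, rate_eq hμ hν hδ]; positivity
  have hη : 1 / stepSize μ ν δ = max δ (min μ ν) := by rw [one_div, inv_stepSize hμ hν hδ]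
  have hη0 : 0 < stepSize μ ν δ := by rw [← one_div_pos, hη]; exact hκ
  choose p hp using fun w => exists_solver (a := μ + max δ (min μ ν)) (b := ν + max δ (min μ ν))
    (l := L + max δ (min μ ν)) hX hXc hY hYc (by positivity) (by positivity)
    (by linarith) (by linarith) hacc hD w
  refine ⟨innerMethod (stepSize μ ν δ) p, fun Γ h w => ?_⟩
  have hs := h.isSaddle_phi hη0 w
  rw [hη] at hs
  obtain ⟨h1, h2⟩ := hp w _ _ _ hs
  rw [run_innerMethod, cost_innerMethod]
  refine ⟨fun x hx y hy => ?_, ?_⟩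
  · refine le_trans (le_of_eq ?_) (h1 ⟨pair x y, hx, hy⟩)
    rw [inner_pt]
    simp only [saddleOp, pair_fst, pair_snd, inner_neg_left, sub_eq_add_neg]
    rfl
  · push_cast
    linarith

end Method

end NearZeroSum

/-! ### Assembly of the theorem -/

theorem mainTheorem1 :
    ∃ C : ℝ, 0 < C ∧
      ∀ (E F : Type*) [NormedAddCommGroup E] [InnerProductSpace ℝ E] [FiniteDimensional ℝ E]
        [NormedAddCommGroup F] [InnerProductSpace ℝ F] [FiniteDimensional ℝ F]
        (X : Set E) (Y : Set F) (DX DY D L μ ν δ ε : ℝ),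
        IsCompact X → Convex ℝ X → IsCompact Y → Convex ℝ Y →
        (∀ x ∈ X, ∀ x' ∈ X, ‖x - x'‖ ≤ DX) → (∀ y ∈ Y, ∀ y' ∈ Y, ‖y - y'‖ ≤ DY) →
        D = Real.sqrt (DX ^ 2 + DY ^ 2) →
        0 < μ → 0 < ν → 0 < ε →
        -- every run of the algorithm, whatever inner-loop method is used, is accurate after
        -- `(1/θ) log (2D²/ε)` outer iterations
        (∀ Γ : Game E F, Γ.IsNearZeroSum X Y L μ ν δ → ∀ (T : ℕ) (z : ℕ → Pt E F),
          Γ.IsICLRun X Y (stepSize μ ν δ) (innerAccuracy μ ν δ ε) T z →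
          1 / rate μ ν δ * Real.log (2 * D ^ 2 / ε) ≤ T →
          Γ.IsAccurateNash X Y ε (z T)) ∧
        -- and some inner-loop method, chosen before the game is known, makes the outer iterates
        -- accurate with the claimed number of gradient queries
        ∃ S : InnerMethod X Y, ∀ Γ : Game E F, Γ.IsNearZeroSum X Y L μ ν δ →
          ∀ z₀ : feasible X Y,
            (∀ T : ℕ, Γ.IsICLRun X Y (stepSize μ ν δ) (innerAccuracy μ ν δ ε) T
              (fun t => (S.iterates Γ z₀ t : Pt E F))) ∧
            (∀ T : ℕ, 1 / rate μ ν δ * Real.log (2 * D ^ 2 / ε) ≤ T →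
              Γ.IsAccurateNash X Y ε (S.iterates Γ z₀ T)) ∧
            (S.totalQueries Γ z₀ ⌈1 / rate μ ν δ * Real.log (2 * D ^ 2 / ε)⌉₊ : ℝ) ≤
              C * (L / Real.sqrt (μ * ν) + L / min μ ν * min 1 (Real.sqrt (δ / (μ + ν)))) *
                max 1 (Real.log (L * D ^ 2 / (min μ ν * ε))) *
                max 1 (Real.log (D ^ 2 / ε)) := by
  refine ⟨10 ^ 6, by norm_num, ?_⟩
  intro E F _ _ _ _ _ _ X Y DX DY D L μ ν δ ε hX hXc hY hYc hDX hDY hDdef hμ hν hε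
  have hD : ∀ u w : feasible X Y, ‖(u : Pt E F) - w‖ ≤ D := by
    rw [hDdef]; exact norm_sub_le_of_diam hDX hDY
  refine ⟨fun Γ h T z hz hT => h.run_accurate hμ hν hε hX hXc hY hYc hD hz hT, ?_⟩
  obtain ⟨S, hS⟩ := exists_innerMethod (L := L) (δ := δ) hX hXc hY hYc hμ hν hε hD
  refine ⟨S, fun Γ h z₀ => ?_⟩
  have hrun : ∀ T : ℕ, Γ.IsICLRun X Y (stepSize μ ν δ) (innerAccuracy μ ν δ ε) T
      (fun t => (S.iterates Γ z₀ t : Pt E F)) := fun T =>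
    ⟨fun t _ => (S.iterates Γ z₀ t).2, fun t _ => (hS Γ h (S.iterates Γ z₀ t)).1⟩
  refine ⟨hrun, fun T hT => h.run_accurate hμ hν hε hX hXc hY hYc hD (hrun T) hT, ?_⟩
  have hm : 0 < min μ ν := lt_min hμ hν
  have hδ := h.delta_mem.1
  have hL : 0 < L := hμ.trans_le h.mu_mem.2
  -- If `2D² ≤ ε`, the ceiling is `0` and no query is made; this includes `D = 0`. Otherwise the
  -- logarithmic bounds apply.
  rcases le_or_gt (2 * D ^ 2) ε with hDε | hDε
  · have h0 : Real.log (2 * D ^ 2 / ε) ≤ 0 :=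
      Real.log_nonpos (by positivity) (by rwa [div_le_one hε])
    have hr : 0 ≤ 1 / rate μ ν δ := by
      rw [rate_eq hμ hν hδ]
      have : 0 ≤ max δ (min μ ν) := hm.le.trans (le_max_right _ _)
      positivity
    rw [Nat.ceil_eq_zero.2 (mul_nonpos_of_nonneg_of_nonpos hr h0)]
    simp only [InnerMethod.totalQueries, Finset.range_zero, Finset.sum_empty, Nat.cast_zero]
    positivity
  set T₀ := ⌈1 / rate μ ν δ * Real.log (2 * D ^ 2 / ε)⌉₊ with hT₀
  have hT := outer_count_le hμ hν hδ hε hDε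
  rw [← hT₀] at hT
  have hlog := solverLog_le hμ hν hδ hε h.mu_mem.2 h.delta_mem.2 hDε
  have hcond := condition_number_le (δ := δ) hμ hν hL
  have hκL : max δ (min μ ν) ≤ L :=
    max_le h.delta_mem.2 ((min_le_left _ _).trans h.mu_mem.2)
  have hκm : min μ ν ≤ max δ (min μ ν) := le_max_right _ _
  have hcost := fun w => (hS Γ h w).2
  have hμL := h.mu_mem.2
  have hνL := h.nu_mem.2
  set m := min μ ν
  set κ := max δ m
  set A := max 1 (Real.log (D ^ 2 / ε))
  set B := max 1 (Real.log (L * D ^ 2 / (m * ε)))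
  set Q := L / √((μ + κ) * (ν + κ)) with hQ
  have hκ : 0 < κ := hm.trans_le hκm
  have hA : 1 ≤ A := le_max_left _ _
  have hB : 1 ≤ B := le_max_left _ _
  have hQ0 : 0 ≤ Q := by positivity
  -- All parameters are at most `L`, so `μ + κ` and `ν + κ` are at most `2L`. This pays for the
  -- single query at `z_t`.
  have hQ1 : 1 ≤ 2 * Q := by
    rw [hQ, ← mul_div_assoc, le_div_iff₀ (by positivity), one_mul]
    refine Real.sqrt_le_iff.2 ⟨by positivity, ?_⟩
    rw [sq]
    exact mul_le_mul (by linarith) (by linarith) (by positivity) (by positivity)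
  -- `156002 = 3000 · 2 · 26 + 2`. Multiplied by the 6 of `outer_count_le` it gives `936012 ≤ 10⁶`.
  have hcost2 : ∀ w : feasible X Y, ((S w).cost (Γ.oracle X Y) : ℝ) ≤ 156002 * Q * B := by
    intro w
    refine (hcost w).trans ?_
    have h1 : (L + κ) / √((μ + κ) * (ν + κ)) ≤ 2 * Q := by
      rw [hQ, ← mul_div_assoc]
      gcongr
      linarith
    have hq : 0 ≤ (L + κ) / √((μ + κ) * (ν + κ)) := by positivity
    calc _ ≤ 3000 * ((L + κ) / √((μ + κ) * (ν + κ))) * (26 * B) + 1 := by gcongr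
      _ ≤ 3000 * (2 * Q) * (26 * B) + 2 * Q * B := by
          gcongr
          nlinarith
      _ = 156002 * Q * B := by ring
  have hsum : (S.totalQueries Γ z₀ T₀ : ℝ) ≤ T₀ * (156002 * Q * B) := by
    rw [InnerMethod.totalQueries, Nat.cast_sum]
    refine (Finset.sum_le_sum fun t _ => hcost2 (S.iterates Γ z₀ t)).trans (le_of_eq ?_)
    rw [Finset.sum_const, Finset.card_range, nsmul_eq_mul]
  calc (S.totalQueries Γ z₀ T₀ : ℝ) ≤ T₀ * (156002 * Q * B) := hsum
    _ ≤ 6 * (κ / m) * A * (156002 * Q * B) := by gcongr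
    _ = 936012 * (κ / m * Q) * B * A := by ring
    _ ≤ 10 ^ 6 * (L / √(μ * ν) + L / m * min 1 (√(δ / (μ + ν)))) * B * A := by
        gcongr
        norm_num
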